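/- Let $N\ge 1$, let $I_1,\dots,I_N$ be positive integers with $\min_n I_n \ge (N-1)\log_2^2(\max_n I_n)+1$, and let $0<\beta\le\alpha$. For a tensor $\mathscr T\in\mathbb R^{I_1\times\cdots\times I_N}$ with entries $t_{\mathbf i}$, $\mathbf i\in[I_1]\times\cdots\times[I_N]$, write $\|\mathscr T\|=\big(\sum_{\mathbf i}t_{\mathbf i}^2\big)^{1/2}$. The CP rank $\mathrm{rank}(\mathscr T)$ is the least $R$ such that $t_{\mathbf i}=\sum_{r=1}^R\prod_{n=1}^N a^{(n)}_r(i_n)$ for all $\mathbf i$, for some vectors $a^{(n)}_r\in\mathbb R^{I_n}$; the nonnegative CP rank $\mathrm{rank}_+(\mathscr T)$ is defined in the same way with all $a^{(n)}_r$ entrywise nonnegative. Let $$S_R(\beta,\alpha)=\{\mathscr T : \beta\le t_{\mathbf i}\le\alpha \text{ for all } \mathbf i,\ \mathrm{rank}(\mathscr T)\le R\},\qquad S_R^+(\beta,\alpha)=\{\mathscr T : \beta\le t_{\mathbf i}\le\alpha \text{ for all } \mathbf i,\ \mathrm{rank}_+(\mathscr T)\le R\}.$$ Fix $R,\tilde R\in\mathbb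 N$, a parameter tensor $\mathscr M$ and a sample size $p$ with $1\le p\le I_1\cdots I_N$. Let $\Omega$ be chosen uniformly at random among all sets of exactly $p=|\Omega|$ multi-indices and, given $\Omega$, let the counts $x_{\mathbf i}$, $\mathbf i\in\Omega$, be independent with $x_{\mathbf i}\sim\mathrm{Poisson}(m_{\mathbf i})$. Let $\Gamma=\{\mathbf i\in\Omega : x_{\mathbf i}\ne 0\}$ and let $$\tilde f_\Gamma(\mathscr T)=\sum_{\mathbf i\in\Gamma}\big(x_{\mathbf i}\log t_{\mathbf i}-\log(e^{t_{\mathbf i}}-1)\big)$$ be the zero-truncated Poisson log-likelihood on $\Gamma$ (without the terms $-\log(x_{\mathbf i}!)$, which do not depend on $\mathscr T$). Put $$K=\frac{64\,\alpha(\alpha+1)\big((4+\beta)e^\beta-4\big)}{(e^\beta-\beta-1)\,\beta^3}\,\big(\alpha(e^2-2)+3\log_2|\Omega|\big)\,\frac{\sqrt{\sum_{n=1}^N I_n}}{\sqrt{|\Omega|}}.$$ (i) If $\mathscr M\in S_R^+(\beta,\alpha)$, then with probability exceeding $1-\frac{2}{|\Omega|}$ (over $\Omega$ and the counts), every $\widetilde{\mathscr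 M}\in S_{\tilde R}^+(\beta,\alpha)$ with $\tilde f_\Gamma(\widetilde{\mathscr M})\ge\tilde f_\Gamma(\mathscr M)$ satisfies $$\frac{\|\mathscr M-\widetilde{\mathscr M}\|^2}{\|\mathscr M\|^2}\le K\,(R+\tilde R).$$ (ii) If $\mathscr M\in S_R(\beta,\alpha)$, then with probability exceeding $1-\frac{2}{|\Omega|}$, every $\widetilde{\mathscr M}\in S_{\tilde R}(\beta,\alpha)$ with $\tilde f_\Gamma(\widetilde{\mathscr M})\ge\tilde f_\Gamma(\mathscr M)$ satisfies $$\frac{\|\mathscr M-\widetilde{\mathscr M}\|^2}{\|\mathscr M\|^2}\le K\,\Big(\big(R\sqrt R\big)^{N-1}+\big(\tilde R\sqrt{\tilde R}\big)^{N-1}\Big).$$ -/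

import Mathlib

open MeasureTheory ProbabilityTheory

noncomputable section

/-- Multi-indices of an array with `N` modes of sizes `I 0, …, I (N-1)`. -/
abbrev MultiIndex {N : ℕ} (I : Fin N → ℕ) : Type := (n : Fin N) → Fin (I n)

/-- Real tensors of size `I 0 × ⋯ × I (N-1)`. -/
abbrev RTensor {N : ℕ} (I : Fin N → ℕ) : Type := MultiIndex I → ℝ

/-- `T` is a sum of `R` rank-one tensors (outer products of one real vector per mode). -/
def HasCPDecomp {N : ℕ} {I : Fin N → ℕ} (T : RTensor I) (R : ℕ) : Prop :=
  ∃ a : Fin R → (n : Fin N) → Fin (I n) → ℝ, ∀ i : MultiIndex I, T i = ∑ r, ∏ n, a r n (i n)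

/-- `T` is a sum of `R` rank-one tensors all of whose factor vectors are nonnegative. -/
def HasNNCPDecomp {N : ℕ} {I : Fin N → ℕ} (T : RTensor I) (R : ℕ) : Prop :=
  ∃ a : Fin R → (n : Fin N) → Fin (I n) → ℝ, (∀ r n k, 0 ≤ a r n k) ∧
    ∀ i : MultiIndex I, T i = ∑ r, ∏ n, a r n (i n)

/-- The CP rank (`⊤` if there is no decomposition). -/
def cpRank {N : ℕ} {I : Fin N → ℕ} (T : RTensor I) : ℕ∞ :=
  ⨅ (R : ℕ) (_ : HasCPDecomp T R), (R : ℕ∞)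

/-- The nonnegative CP rank (`⊤` if there is no nonnegative decomposition). -/
def nncpRank {N : ℕ} {I : Fin N → ℕ} (T : RTensor I) : ℕ∞ :=
  ⨅ (R : ℕ) (_ : HasNNCPDecomp T R), (R : ℕ∞)

/-- `S_R(β, α)`: tensors with entries in `[β, α]` and CP rank at most `R`. -/
def cpSpace {N : ℕ} (I : Fin N → ℕ) (R : ℕ) (β α : ℝ) : Set (RTensor I) :=
  {T | (∀ i, β ≤ T i ∧ T i ≤ α) ∧ cpRank T ≤ R}

/-- `S_R⁺(β, α)`: tensors with entries in `[β, α]` and nonnegative CP rank at most `R`. -/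
def nncpSpace {N : ℕ} (I : Fin N → ℕ) (R : ℕ) (β α : ℝ) : Set (RTensor I) :=
  {T | (∀ i, β ≤ T i ∧ T i ≤ α) ∧ nncpRank T ≤ R}

/-- The Frobenius norm of a tensor. -/
def frobNorm {N : ℕ} {I : Fin N → ℕ} (T : RTensor I) : ℝ :=
  √(∑ i, T i ^ 2)

/-- The set `Γ` of indices in `Ω` whose count is nonzero. -/
def nonzeroEntries {N : ℕ} {I : Fin N → ℕ} (Ω : Finset (MultiIndex I)) (x : MultiIndex I → ℕ) :
    Finset (MultiIndex I) :=
  Ω.filter (fun i => x i ≠ 0)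

/-- The zero-truncated Poisson log-likelihood of the parameter tensor `T` on the index set `G`,
given the counts `x`, without the terms `- log (x i)!` that do not depend on `T`. -/
def ztpLogLik {N : ℕ} {I : Fin N → ℕ} (G : Finset (MultiIndex I)) (x : MultiIndex I → ℕ)
    (T : RTensor I) : ℝ :=
  ∑ i ∈ G, ((x i : ℝ) * Real.log (T i) - Real.log (Real.exp (T i) - 1))

/-- The sampling model with parameter tensor `M` and sample size `p`: the random index set `Ω` is
uniform among all sets of `p` multi-indices and, given `Ω`, the counts `X i` with `i ∈ Ω` are
independent and `X i` is Poisson with mean `M i`. Nothing is said about the counts off `Ω`. -/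
structure IsPoissonSample {N : ℕ} {I : Fin N → ℕ} {E : Type*} [MeasurableSpace E] (μ : Measure E)
    (M : RTensor I) (p : ℕ) (Ω : E → Finset (MultiIndex I)) (X : E → MultiIndex I → ℕ) : Prop where
  measurable_index : ∀ s : Finset (MultiIndex I), MeasurableSet {ω | Ω ω = s}
  measurable_count : ∀ i : MultiIndex I, Measurable (fun ω => X ω i)
  uniform_index : ∀ s : Finset (MultiIndex I), μ.real {ω | Ω ω = s} =
    if s.card = p then 1 / ((Fintype.card (MultiIndex I)).choose p : ℝ) else 0
  indep_count : ∀ s : Finset (MultiIndex I), s.card = p →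
    iIndepFun (fun (i : {i // i ∈ s}) ω => X ω i) (ProbabilityTheory.cond μ {ω | Ω ω = s})
  law_count : ∀ s : Finset (MultiIndex I), s.card = p → ∀ i ∈ s,
    (ProbabilityTheory.cond μ {ω | Ω ω = s}).map (fun ω => X ω i) = poissonMeasure (M i).toNNReal

/-- The factor of the error bound that depends on `α`, `β`, the sample size and the mode sizes,
but not on the ranks. -/
def errorFactor {N : ℕ} (I : Fin N → ℕ) (α β : ℝ) (p : ℕ) : ℝ :=
  64 * α * (α + 1) * ((4 + β) * Real.exp β - 4) / ((Real.exp β - β - 1) * β ^ 3)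
    * (α * (Real.exp 2 - 2) + 3 * Real.logb 2 p)
    * (√(∑ n, (I n : ℝ)) / √(p : ℝ))

end

/-! Let `T` be at least as likely as `M` and yet far from it. The expected log-likelihood ratio of a
sampled entry is minus a multiple of a Kullback-Leibler divergence, at most -c (T i - M i)²
(`expected_ztp_le`). Hence, if entries are observed with probability q, the centred log-likelihood
process at `T` must exceed q c ‖M - T‖². What is needed is an exponential moment of the supremum of
this process over the class.

Three devices give it. Write n = ∏ I_k and S = ∑ I_k. (a) Uniform sets of size p are dominated, up
to a factor n + 1, by independent sampling with q = p / n (`IsPoissonSample.measure_preimage_le`),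
so that the coordinates become independent. (b) Symmetrization and contraction for exponential
moments (`lintegral_supExp_sum_le`) replace the likelihood terms, which are Lipschitz with constant
x (1 + 1/β), by linear terms with randomly signed counts. (c) `T - M` lies in a multiple of the hull
of the signed sign tensors (`IsSignBounded`). The multiple is (R + R') α for nonnegative rank, where
terms cannot cancel, and (R^(N-1) + R'^(N-1)) α for rank, by choosing slices of maximal determinant
(`isSignBounded_of_rank`). There are only 2^S sign tensors, so the supremum costs a factor 2^(S+1),
and the Poisson moments cost e^(2S).

A Chernoff exponent of 6 S beats all these factors (`IsPoissonSample.measure_deviation_lt`). This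
settles S ≤ p; for p ≤ S the claimed bound is at least α² / β² and holds for every tensor with
entries in [β, α]. Suprema over the uncountable class stay measurable because the counts range over
a countable discrete space. -/

/-! ### Scalar estimates for the zero-truncated Poisson likelihood. -/

/-- The contribution of a single count `x` to the zero-truncated Poisson log-likelihood; a zero
count contributes nothing. -/
noncomputable def ztpTerm (x : ℕ) (t : ℝ) : ℝ :=
  if x = 0 then 0 else (x : ℝ) * Real.log t - Real.log (Real.exp t - 1)

theorem log_sub_log_le_div {b s t : ℝ} (hb : 0 < b) (hs : b ≤ s) (hst : s ≤ t) :
    Real.log t - Real.log s ≤ (t - s) / b := by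
  have hs0 : 0 < s := hb.trans_le hs
  have ht0 : 0 < t := hs0.trans_le hst
  rw [← Real.log_div ht0.ne' hs0.ne']
  calc Real.log (t / s) ≤ t / s - 1 := Real.log_le_sub_one_of_pos (by positivity)
    _ = (t - s) / s := by field_simp
    _ ≤ (t - s) / b := by gcongr

theorem exp_sub_one_pos {t : ℝ} (ht : 0 < t) : 0 < Real.exp t - 1 := by
  have := Real.add_one_lt_exp ht.ne'
  linarith

/-- The slope is 1 + 1 / (e^u - 1), and e^u - 1 ≥ u ≥ b. Splitting off the factor e^u isolates the
slope 1; the remaining logarithm contributes 1 / b. -/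
theorem log_exp_sub_one_sub_le {b s t : ℝ} (hb : 0 < b) (hs : b ≤ s) (hst : s ≤ t) :
    Real.log (Real.exp t - 1) - Real.log (Real.exp s - 1) ≤ (1 + 1 / b) * (t - s) := by
  have hs0 : 0 < s := hb.trans_le hs
  have ht0 : 0 < t := hs0.trans_le hst
  have h : ∀ u, 0 < u → Real.log (Real.exp u - 1) = u + Real.log (1 - Real.exp (-u)) := by
    intro u hu
    have h1 : 0 < 1 - Real.exp (-u) := by
      have : Real.exp (-u) < 1 := by rw [Real.exp_lt_one_iff]; linarith
      linarith
    rw [show Real.exp u - 1 = Real.exp u * (1 - Real.exp (-u)) by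
      rw [mul_sub, ← Real.exp_add]; simp, Real.log_mul (Real.exp_pos u).ne' h1.ne', Real.log_exp]
  have hes := exp_sub_one_pos hs0
  have het := exp_sub_one_pos ht0
  have hE : 0 < 1 - Real.exp (-s) := by
    have : Real.exp (-s) < 1 := by rw [Real.exp_lt_one_iff]; linarith
    linarith
  have hE' : 0 < 1 - Real.exp (-t) := by
    have : Real.exp (-t) < 1 := by rw [Real.exp_lt_one_iff]; linarith
    linarith
  rw [h t ht0, h s hs0]
  have h2 : Real.log (1 - Real.exp (-t)) - Real.log (1 - Real.exp (-s)) ≤ (t - s) / b := by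
    rw [← Real.log_div hE'.ne' hE.ne']
    refine (Real.log_le_sub_one_of_pos (by positivity)).trans ?_
    have h3 : (1 - Real.exp (-t)) / (1 - Real.exp (-s)) - 1
        = (1 - Real.exp (-(t - s))) / (Real.exp s - 1) := by
      rw [div_sub_one hE.ne', div_eq_div_iff hE.ne' hes.ne']
      have e1 : Real.exp (-(t - s)) = Real.exp (-t) * Real.exp s := by
        rw [← Real.exp_add]; ring_nf
      have e2 : Real.exp (-s) * Real.exp s = 1 := by rw [← Real.exp_add]; simp
      rw [e1]
      linear_combination (1 - Real.exp (-t)) * e2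
    rw [h3]
    have h4 : 1 - Real.exp (-(t - s)) ≤ t - s := by
      have := Real.add_one_le_exp (-(t - s)); linarith
    have h5 : b ≤ Real.exp s - 1 := by
      have := Real.add_one_le_exp s; linarith
    exact div_le_div₀ (by linarith) h4 hb h5
  have : (1 + 1 / b) * (t - s) = (t - s) + (t - s) / b := by ring
  linarith

/-- Both parts of the term increase in the parameter, so their increments partly cancel and only the
larger one counts. A nonzero count is at least 1, which lets the second increment carry the factor
`x` too. -/
theorem abs_ztpTerm_sub_le {b s t : ℝ} (hb : 0 < b) (hs : b ≤ s) (ht : b ≤ t) (x : ℕ) :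
    |ztpTerm x t - ztpTerm x s| ≤ x * (1 + 1 / b) * |t - s| := by
  wlog hst : s ≤ t generalizing s t
  · rw [abs_sub_comm, abs_sub_comm t]
    exact this ht hs (le_of_not_ge hst)
  rcases Nat.eq_zero_or_pos x with rfl | hx
  · simp [ztpTerm]
  have hx1 : (1 : ℝ) ≤ x := by exact_mod_cast hx
  have hs0 : 0 < s := hb.trans_le hs
  have h1 := log_sub_log_le_div hb hs hst
  have h2 := log_exp_sub_one_sub_le hb hs hst
  have h3 : Real.log s ≤ Real.log t := Real.log_le_log hs0 hst
  have h4 : Real.log (Real.exp s - 1) ≤ Real.log (Real.exp t - 1) :=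
    Real.log_le_log (exp_sub_one_pos hs0) (by gcongr)
  have h5 : (x : ℝ) * (Real.log t - Real.log s) ≤ x * ((t - s) / b) := by gcongr
  have h6 : 0 ≤ (x : ℝ) * (Real.log t - Real.log s) := by
    apply mul_nonneg <;> linarith
  have h7 : 1 * ((1 + 1 / b) * (t - s)) ≤ x * ((1 + 1 / b) * (t - s)) := by
    gcongr
  have h8 : (x : ℝ) * ((t - s) / b) ≤ x * (1 + 1 / b) * (t - s) := by
    have : (x : ℝ) * (1 + 1 / b) * (t - s) = x * ((t - s) / b) + x * (t - s) := by ring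
    have : 0 ≤ (x : ℝ) * (t - s) := by apply mul_nonneg <;> linarith
    linarith
  rw [abs_of_nonneg (sub_nonneg.2 hst), abs_le]
  simp only [ztpTerm, hx.ne', if_false]
  constructor <;> nlinarith

/-- The mean of the zero-truncated Poisson law grows at slope at least `1/2` in its parameter. -/
theorem half_sub_le_ztp_mean_sub {s t : ℝ} (hs : 0 < s) (hst : s ≤ t) :
    (t - s) / 2 ≤ t / (1 - Real.exp (-t)) - s / (1 - Real.exp (-s)) := by
  have hpos : ∀ u : ℝ, 0 < u → 0 < 1 - Real.exp (-u) := by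
    intro u hu
    have : Real.exp (-u) < 1 := by rw [Real.exp_lt_one_iff]; linarith
    linarith
  have hd : ∀ u ∈ Set.Ioi (0 : ℝ), HasDerivAt (fun u => u / (1 - Real.exp (-u)) - u / 2)
      ((1 * (1 - Real.exp (-u)) - u * (-(Real.exp (-u) * (-1)))) / (1 - Real.exp (-u)) ^ 2 - 1 / 2)
      u := by
    intro u hu
    have h1 : HasDerivAt (fun u : ℝ => 1 - Real.exp (-u)) (-(Real.exp (-u) * (-1))) u :=
      ((hasDerivAt_neg u).exp).const_sub 1
    exact ((hasDerivAt_id u).div h1 (hpos u hu).ne').sub ((hasDerivAt_id u).div_const 2)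
  have hm : MonotoneOn (fun u => u / (1 - Real.exp (-u)) - u / 2) (Set.Ioi (0 : ℝ)) := by
    refine monotoneOn_of_deriv_nonneg (convex_Ioi 0)
      (fun u hu => (hd u hu).continuousAt.continuousWithinAt)
      (fun u hu => ?_) (fun u hu => ?_)
    · rw [interior_Ioi] at hu
      exact (hd u hu).differentiableAt.differentiableWithinAt
    · rw [interior_Ioi] at hu
      rw [(hd u hu).deriv, sub_nonneg, div_le_div_iff₀ (by norm_num) (pow_pos (hpos u hu) 2)]
      -- After clearing denominators the claim on the derivative is exactly u ≤ sinh u.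
      have h2 : u ≤ Real.sinh u := Real.self_le_sinh_iff.2 (le_of_lt hu)
      rw [Real.sinh_eq] at h2
      have e2 : Real.exp (-u) * Real.exp u = 1 := by rw [← Real.exp_add]; simp
      have e0 := Real.exp_pos (-u)
      have h3 : Real.exp (-u) * (2 * u) ≤ Real.exp (-u) * (Real.exp u - Real.exp (-u)) := by
        gcongr; linarith
      nlinarith
  have := hm (show s ∈ Set.Ioi 0 from hs) (show t ∈ Set.Ioi 0 from hs.trans_le hst) hst
  simp only at this
  linarith

theorem hasDerivAt_expected_ztp (m c : ℝ) {t : ℝ} (ht : 0 < t) :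
    HasDerivAt (fun t => m * Real.log t - (1 - Real.exp (-m)) * Real.log (Real.exp t - 1)
      + c * (t - m) ^ 2)
      (m * t⁻¹ - (1 - Real.exp (-m)) * (Real.exp t / (Real.exp t - 1)) + c * (2 * (t - m))) t := by
  have h1 := (Real.hasDerivAt_log ht.ne').const_mul m
  have h2 := ((((Real.hasDerivAt_exp t).sub_const 1).log (exp_sub_one_pos ht).ne').const_mul
    (1 - Real.exp (-m)))
  have h3 : HasDerivAt (fun t => c * (t - m) ^ 2) (c * (2 * (t - m))) t := by
    have := (((hasDerivAt_id t).sub_const m).pow 2).const_mul c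
    simpa using this
  exact (h1.sub h2).add h3

/-- The score of an exponential family is a difference of means: t / (1 - e^(-t)) is the mean of the
zero-truncated law. -/
theorem expected_ztp_deriv_eq {m c t : ℝ} (hm : 0 < m) (ht : 0 < t) :
    m * t⁻¹ - (1 - Real.exp (-m)) * (Real.exp t / (Real.exp t - 1)) + c * (2 * (t - m)) =
      -((1 - Real.exp (-m)) / t *
        (t / (1 - Real.exp (-t)) - m / (1 - Real.exp (-m)))) + c * (2 * (t - m)) := by
  have hpos : ∀ u : ℝ, 0 < u → 1 - Real.exp (-u) ≠ 0 := by
    intro u hu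
    have : Real.exp (-u) < 1 := by rw [Real.exp_lt_one_iff]; linarith
    linarith
  have h1 : Real.exp t / (Real.exp t - 1) = 1 / (1 - Real.exp (-t)) := by
    rw [div_eq_div_iff (exp_sub_one_pos ht).ne' (hpos t ht)]
    have e2 : Real.exp (-t) * Real.exp t = 1 := by rw [← Real.exp_add]; simp
    linear_combination -e2
  rw [h1]
  have := hpos t ht
  have := hpos m hm
  field_simp
  ring

/-- The expected zero-truncated log-likelihood ratio is strongly concave around the true
parameter: a quadratic lower bound for the Kullback-Leibler divergence. -/
theorem expected_ztp_le {α β m t : ℝ} (hβ : 0 < β) (hm : β ≤ m) (hmα : m ≤ α) (ht : β ≤ t)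
    (htα : t ≤ α) :
    m * (Real.log t - Real.log m) - (1 - Real.exp (-m)) *
      (Real.log (Real.exp t - 1) - Real.log (Real.exp m - 1))
      ≤ -((1 - Real.exp (-β)) / (4 * α) * (t - m) ^ 2) := by
  set c := (1 - Real.exp (-β)) / (4 * α) with hc
  have hm0 : 0 < m := hβ.trans_le hm
  have hα : 0 < α := hm0.trans_le hmα
  have hb : 0 < 1 - Real.exp (-β) := by
    have : Real.exp (-β) < 1 := by rw [Real.exp_lt_one_iff]; linarith
    linarith
  have hbm : 1 - Real.exp (-β) ≤ 1 - Real.exp (-m) := by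
    have : Real.exp (-m) ≤ Real.exp (-β) := by gcongr
    linarith
  -- This determines `c`: the prefactor of the score is at least 4 c and the means differ by at
  -- least half the parameter difference, so the score outweighs 2 c |t - m|, the slope of the added
  -- quadratic.
  have hcu : ∀ u, 0 < u → u ≤ α → 4 * c ≤ (1 - Real.exp (-m)) / u := by
    intro u hu huα
    rw [hc, show 4 * ((1 - Real.exp (-β)) / (4 * α)) = (1 - Real.exp (-β)) / α by field_simp]
    exact div_le_div₀ (by linarith) hbm hu huα
  set φ := fun t => m * Real.log t - (1 - Real.exp (-m)) * Real.log (Real.exp t - 1)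
      + c * (t - m) ^ 2 with hφ
  have hcpos : 0 < c := by positivity
  have key : φ t ≤ φ m := by
    rcases le_total m t with hmt | hmt
    · have : AntitoneOn φ (Set.Icc m α) := by
        refine antitoneOn_of_deriv_nonpos (convex_Icc m α)
          (fun u hu => (hasDerivAt_expected_ztp m c
            (hm0.trans_le hu.1)).continuousAt.continuousWithinAt)
          (fun u hu => ?_) (fun u hu => ?_)
        · rw [interior_Icc] at hu
          exact (hasDerivAt_expected_ztp m c
            (hm0.trans hu.1)).differentiableAt.differentiableWithinAt
        · rw [interior_Icc] at hu
          have hu0 : 0 < u := hm0.trans hu.1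
          rw [(hasDerivAt_expected_ztp m c hu0).deriv, expected_ztp_deriv_eq hm0 hu0]
          have h1 := half_sub_le_ztp_mean_sub hm0 hu.1.le
          have h2 := hcu u hu0 hu.2.le
          have h3 : 4 * c * ((u - m) / 2) ≤ (1 - Real.exp (-m)) / u *
              (u / (1 - Real.exp (-u)) - m / (1 - Real.exp (-m))) :=
            mul_le_mul h2 h1 (by linarith [hu.1]) (le_trans (by positivity) h2)
          linarith
      exact this ⟨le_rfl, hmα⟩ ⟨hmt, htα⟩ hmt
    · have : MonotoneOn φ (Set.Icc β m) := by
        refine monotoneOn_of_deriv_nonneg (convex_Icc β m)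
          (fun u hu => (hasDerivAt_expected_ztp m c
            (hβ.trans_le hu.1)).continuousAt.continuousWithinAt)
          (fun u hu => ?_) (fun u hu => ?_)
        · rw [interior_Icc] at hu
          exact (hasDerivAt_expected_ztp m c
            (hβ.trans hu.1)).differentiableAt.differentiableWithinAt
        · rw [interior_Icc] at hu
          have hu0 : 0 < u := hβ.trans hu.1
          rw [(hasDerivAt_expected_ztp m c hu0).deriv, expected_ztp_deriv_eq hm0 hu0]
          have h1 := half_sub_le_ztp_mean_sub hu0 hu.2.le
          have h2 := hcu u hu0 (hu.2.le.trans hmα)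
          have h3 : 4 * c * ((m - u) / 2) ≤ (1 - Real.exp (-m)) / u *
              (m / (1 - Real.exp (-m)) - u / (1 - Real.exp (-u))) :=
            mul_le_mul h2 h1 (by linarith [hu.2]) (le_trans (by positivity) h2)
          linarith
      exact this ⟨ht, hmt⟩ ⟨hm, le_rfl⟩ hmt
  simp only [hφ, sub_self] at key
  nlinarith

/-- Averaging over the two signs removes the term linear in s, leaving at most e^v with v = s² α (α
+ 1). The restriction on s gives v ≤ 1, hence e^v ≤ 1 + 2 v; the bound is kept linear because it
will be mixed with a point mass at zero. -/
theorem poisson_cosh_mgf_le {α m s : ℝ} (hm : 0 ≤ m) (hmα : m ≤ α) (hs : 0 ≤ s)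
    (hsα : s * (α + 1) ≤ 1) :
    (Real.exp (m * (Real.exp s - 1)) + Real.exp (m * (Real.exp (-s) - 1))) / 2
      ≤ 1 + 2 * (s ^ 2 * (α * (α + 1))) := by
  have hα : 0 ≤ α := hm.trans hmα
  have hs1 : s ≤ 1 := by nlinarith
  have h1 : Real.exp s - 1 ≤ s + s ^ 2 := by
    have := Real.abs_exp_sub_one_sub_id_le (x := s) (by rw [abs_of_nonneg hs]; exact hs1)
    have := (abs_le.1 this).2
    linarith
  have h2 : Real.exp (-s) - 1 ≤ -s + s ^ 2 := by
    have := Real.abs_exp_sub_one_sub_id_le (x := -s)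
      (by rw [abs_neg, abs_of_nonneg hs]; exact hs1)
    have := (abs_le.1 this).2
    have e : (-s) ^ 2 = s ^ 2 := by ring
    linarith
  set v := s ^ 2 * (α * (α + 1)) with hv
  have hv0 : 0 ≤ v := by positivity
  have hv1 : v ≤ 1 := by
    have : v ≤ (s * (α + 1)) ^ 2 := by rw [hv]; nlinarith [sq_nonneg s]
    have h0 : 0 ≤ s * (α + 1) := by positivity
    nlinarith
  have hcosh : (Real.exp (m * (Real.exp s - 1)) + Real.exp (m * (Real.exp (-s) - 1))) / 2
      ≤ Real.exp v := by
    calc _ ≤ (Real.exp (m * (s + s ^ 2)) + Real.exp (m * (-s + s ^ 2))) / 2 := by gcongr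
      _ = Real.exp (m * s ^ 2) * Real.cosh (m * s) := by
        rw [Real.cosh_eq, mul_div_assoc', mul_add (Real.exp _), ← Real.exp_add, ← Real.exp_add]
        ring_nf
      _ ≤ Real.exp (m * s ^ 2) * Real.exp ((m * s) ^ 2 / 2) := by
        gcongr; exact Real.cosh_le_exp_half_sq _
      _ = Real.exp (m * s ^ 2 + (m * s) ^ 2 / 2) := by rw [Real.exp_add]
      _ ≤ Real.exp v := by
        rw [Real.exp_le_exp, hv]
        have : m ^ 2 ≤ α ^ 2 := by gcongr
        nlinarith [sq_nonneg s, mul_le_mul_of_nonneg_left hmα (sq_nonneg s),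
          mul_le_mul_of_nonneg_left this (sq_nonneg s), mul_nonneg (sq_nonneg s) (sq_nonneg m)]
  have hev : Real.exp v ≤ 1 + 2 * v := by
    have := Real.abs_exp_sub_one_sub_id_le (x := v) (by rw [abs_of_nonneg hv0]; exact hv1)
    have := (abs_le.1 this).2
    nlinarith
  linarith

/-! ### Lower bounds for the constant in the error bound. -/

/-- The value of the logarithm-of-sample-size factor in the error bound is at least `5 α`. -/
theorem five_mul_le_log_factor {α : ℝ} (hα : 0 < α) {p : ℕ} (hp : 1 ≤ p) :
    5 * α ≤ α * (Real.exp 2 - 2) + 3 * Real.logb 2 p := by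
  have h1 : (7 : ℝ) ≤ Real.exp 2 := by
    have h := Real.exp_one_gt_d9
    have : Real.exp 2 = Real.exp 1 * Real.exp 1 := by rw [← Real.exp_add]; norm_num
    rw [this]; nlinarith
  have h2 : 0 ≤ Real.logb 2 (p : ℝ) :=
    Real.logb_nonneg (by norm_num) (by exact_mod_cast hp)
  nlinarith

theorem exp_sub_sub_one_pos {β : ℝ} (hβ : 0 < β) : 0 < Real.exp β - β - 1 := by
  have := Real.add_one_lt_exp hβ.ne'
  linarith

/-- The numerical factor of the error bound dominates the one produced by the empirical process
bound. -/
theorem le_errorFactor_mul {N : ℕ} (I : Fin N → ℕ) {α β : ℝ} (hβ : 0 < β) (hβα : β ≤ α) {p : ℕ}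
    (hp : 1 ≤ p) :
    12 * α * (α + 1) * (1 + 1 / β) * (√(∑ n, (I n : ℝ)) / √(p : ℝ)) ≤
      errorFactor I α β p * ((1 - Real.exp (-β)) / (4 * α) * β ^ 2) := by
  have hα : 0 < α := hβ.trans_le hβα
  have hD := exp_sub_sub_one_pos hβ
  have hb : 0 < 1 - Real.exp (-β) := by
    have : Real.exp (-β) < 1 := by rw [Real.exp_lt_one_iff]; linarith
    linarith
  have e2 : Real.exp (-β) * Real.exp β = 1 := by rw [← Real.exp_add]; simp
  -- Together with the lower bound 5 α for the logarithmic factor this yields the constant 16 · 5 /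
  -- 2 = 40, more than the 12 required.
  have hQ : (1 + 1 / β) / 2 ≤ ((4 + β) * Real.exp β - 4) * (1 - Real.exp (-β)) /
      ((Real.exp β - β - 1) * β) := by
    rw [show (1 + 1 / β) / 2 = (β + 1) / (2 * β) by field_simp,
      div_le_div_iff₀ (by positivity) (by positivity)]
    have h1 : Real.exp β - 1 - β ≤ β * (Real.exp β - 1) := by
      have := Real.add_one_le_exp (-β)
      nlinarith [Real.exp_pos β]
    have h2 : β * (Real.exp β - 1) ≤ ((4 + β) * Real.exp β - 4) * (1 - Real.exp (-β)) := by
      have : ((4 + β) * Real.exp β - 4) * (1 - Real.exp (-β)) =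
        β * (Real.exp β - 1) + 4 * (Real.exp β - 1) * (1 - Real.exp (-β)) := by
        linear_combination (-β) * e2
      rw [this]
      have := exp_sub_one_pos hβ
      have : 0 ≤ 4 * (Real.exp β - 1) * (1 - Real.exp (-β)) := by positivity
      linarith
    have h3 : (β + 1) * (Real.exp β - β - 1) ≤ 2 * (β * (Real.exp β - 1)) := by nlinarith
    nlinarith
  have hL := five_mul_le_log_factor hα hp
  have heq : errorFactor I α β p * ((1 - Real.exp (-β)) / (4 * α) * β ^ 2) =
      16 * (α + 1) * (((4 + β) * Real.exp β - 4) * (1 - Real.exp (-β)) /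
      ((Real.exp β - β - 1) * β)) * (α * (Real.exp 2 - 2) + 3 * Real.logb 2 p)
      * (√(∑ n, (I n : ℝ)) / √(p : ℝ)) := by
    unfold errorFactor
    field_simp
    ring
  rw [heq]
  refine mul_le_mul_of_nonneg_right ?_ (by positivity)
  calc 12 * α * (α + 1) * (1 + 1 / β) ≤ 16 * (α + 1) * ((1 + 1 / β) / 2) * (5 * α) := by
        have : 0 ≤ α * (α + 1) * (1 + 1 / β) := by positivity
        nlinarith
    _ ≤ _ := by
        have : 0 ≤ (1 + 1 / β) / 2 := by positivity
        gcongr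
        exact mul_nonneg (by positivity) (this.trans hQ)

/-- Serves small samples: the left side bounds the relative error of any two tensors with entries in
[β, α], and the last factor of the bound is at least 1 here. -/
theorem sq_div_sq_le_errorFactor_mul_two {N : ℕ} (I : Fin N → ℕ) {α β : ℝ} (hβ : 0 < β)
    (hβα : β ≤ α) {p : ℕ} (hp : 1 ≤ p) (hpS : (p : ℝ) ≤ ∑ n, (I n : ℝ)) :
    α ^ 2 / β ^ 2 ≤ errorFactor I α β p * 2 := by
  have hα : 0 < α := hβ.trans_le hβα
  have hD := exp_sub_sub_one_pos hβ
  have hp0 : (0 : ℝ) < p := by exact_mod_cast hp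
  have hL := five_mul_le_log_factor hα hp
  have hQ : 1 ≤ ((4 + β) * Real.exp β - 4) / (Real.exp β - β - 1) := by
    rw [one_le_div hD]
    have := exp_sub_one_pos hβ
    nlinarith [Real.exp_pos β, mul_pos hβ (Real.exp_pos β)]
  have hS : 1 ≤ √(∑ n, (I n : ℝ)) / √(p : ℝ) := by
    rw [one_le_div (Real.sqrt_pos.2 hp0)]
    exact Real.sqrt_le_sqrt hpS
  have heq : errorFactor I α β p * 2 = 128 * α * (α + 1) / β ^ 3 *
      (((4 + β) * Real.exp β - 4) / (Real.exp β - β - 1)) *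
      (α * (Real.exp 2 - 2) + 3 * Real.logb 2 p) * (√(∑ n, (I n : ℝ)) / √(p : ℝ)) := by
    unfold errorFactor
    field_simp
    ring
  rw [heq]
  calc α ^ 2 / β ^ 2 ≤ 128 * α * (α + 1) / β ^ 3 * 1 * (5 * α) * 1 := by
        rw [show 128 * α * (α + 1) / β ^ 3 * 1 * (5 * α) * 1
          = (640 * α ^ 2 * (α + 1)) / β ^ 3 by ring,
          div_le_div_iff₀ (by positivity) (by positivity)]
        have : α ^ 2 * β ^ 2 * β ≤ α ^ 2 * β ^ 2 * (640 * (α + 1)) := by gcongr; linarith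
        nlinarith
    _ ≤ _ := by
        have h1 := zero_le_one.trans hQ
        have h2 : 0 ≤ α * (Real.exp 2 - 2) + 3 * Real.logb 2 p := le_trans (by positivity) hL
        gcongr

/-! ### The hull of the sign tensors. -/

/-- The tensor with entries `∏ n, ±1` prescribed by one sign vector per mode. -/
def signTensor {N : ℕ} {I : Fin N → ℕ} (σ : (n : Fin N) → Fin (I n) → Bool) : RTensor I :=
  fun i => ∏ n, if σ n (i n) then 1 else -1

/-- `T` lies in the multiple by `ρ` of the convex hull of the signed sign tensors, expressed by
duality. -/
def IsSignBounded {N : ℕ} {I : Fin N → ℕ} (ρ : ℝ) (T : RTensor I) : Prop :=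
  ∀ η : RTensor I, ∃ σ : (n : Fin N) → Fin (I n) → Bool,
    |∑ i, η i * T i| ≤ ρ * |∑ i, η i * signTensor σ i|

namespace IsSignBounded

variable {N : ℕ} {I : Fin N → ℕ} {ρ ρ' : ℝ} {S T : RTensor I}

theorem mono (h : IsSignBounded ρ T) (hρ : ρ ≤ ρ') : IsSignBounded ρ' T := fun η => by
  obtain ⟨σ, hσ⟩ := h η
  exact ⟨σ, hσ.trans (by gcongr)⟩

theorem zero : IsSignBounded 0 (0 : RTensor I) := fun η => ⟨fun _ _ => true, by simp⟩

theorem neg (h : IsSignBounded ρ T) : IsSignBounded ρ (-T) := fun η => by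
  obtain ⟨σ, hσ⟩ := h η
  exact ⟨σ, by simpa [Finset.sum_neg_distrib] using hσ⟩

theorem add (hS : IsSignBounded ρ S) (hT : IsSignBounded ρ' T) (hρ : 0 ≤ ρ) (hρ' : 0 ≤ ρ') :
    IsSignBounded (ρ + ρ') (S + T) := fun η => by
  obtain ⟨σ, hσ⟩ := hS η
  obtain ⟨τ, hτ⟩ := hT η
  have h : |∑ i, η i * (S + T) i| ≤ |∑ i, η i * S i| + |∑ i, η i * T i| := by
    simpa [mul_add, Finset.sum_add_distrib] using abs_add_le (∑ i, η i * S i) (∑ i, η i * T i)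
  -- One sign tensor has to serve both summands; the one with the larger pairing does.
  rcases le_total |∑ i, η i * signTensor σ i| |∑ i, η i * signTensor τ i| with hle | hle
  · refine ⟨τ, h.trans ?_⟩
    have := mul_le_mul_of_nonneg_left hle hρ
    linarith
  · refine ⟨σ, h.trans ?_⟩
    have := mul_le_mul_of_nonneg_left hle hρ'
    linarith

theorem sum {κ : Type*} (s : Finset κ) {F : κ → RTensor I} (hρ : 0 ≤ ρ)
    (h : ∀ r ∈ s, IsSignBounded ρ (F r)) : IsSignBounded (s.card * ρ) (∑ r ∈ s, F r) := by
  classical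
  induction s using Finset.induction_on with
  | empty => simpa using zero
  | insert a s ha ih =>
    rw [Finset.sum_insert ha, Finset.card_insert_of_notMem ha]
    have h1 := (h a (Finset.mem_insert_self a s)).add
      (ih fun r hr => h r (Finset.mem_insert_of_mem hr)) hρ (by positivity)
    exact h1.mono (by push_cast; linarith)

end IsSignBounded

theorem sum_multiIndex_succ {N : ℕ} {I : Fin (N + 1) → ℕ} (F : MultiIndex I → ℝ) :
    ∑ i, F i = ∑ k : Fin (I 0), ∑ j : MultiIndex (fun n : Fin N => I n.succ),
      F (Fin.cons (α := fun n => Fin (I n)) k j) := by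
  rw [← Fintype.sum_prod_type']
  exact (Equiv.sum_comp (Fin.consEquiv fun n => Fin (I n)) F).symm

/-- Contract η with `u` in the first mode and take the signs that `T` supplies for the other modes.
Choosing each first-mode sign to match the pairing `w k` of the k-th slice turns the total pairing
into ∑ |w k|, which dominates ∑ u k * w k up to `c`. -/
theorem IsSignBounded.cons {N : ℕ} {I : Fin (N + 1) → ℕ} {ρ c : ℝ} (hρ : 0 ≤ ρ)
    {u : Fin (I 0) → ℝ} (hu : ∀ k, |u k| ≤ c) {T : RTensor (fun n : Fin N => I n.succ)}
    (hT : IsSignBounded ρ T) :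
    IsSignBounded (I := I) (c * ρ) (fun i => u (i 0) * T (fun n => i n.succ)) := fun η => by
  classical
  obtain ⟨σ, hσ⟩ := hT (fun j => ∑ k, η (Fin.cons (α := fun n => Fin (I n)) k j) * u k)
  set w : Fin (I 0) → ℝ := fun k =>
    ∑ j, η (Fin.cons (α := fun n => Fin (I n)) k j) * signTensor σ j with hw
  refine ⟨Fin.cons (α := fun n => Fin (I n) → Bool) (fun k => decide (0 ≤ w k)) σ, ?_⟩
  have h1 : ∑ i, η i * (u (i 0) * T (fun n => i n.succ)) =
      ∑ j, (∑ k, η (Fin.cons (α := fun n => Fin (I n)) k j) * u k) * T j := by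
    rw [sum_multiIndex_succ, Finset.sum_comm]
    refine Finset.sum_congr rfl fun j _ => ?_
    rw [Finset.sum_mul]
    refine Finset.sum_congr rfl fun k _ => ?_
    simp [mul_assoc]
  have h2 : ∑ j, (∑ k, η (Fin.cons (α := fun n => Fin (I n)) k j) * u k) * signTensor σ j
      = ∑ k, u k * w k := by
    simp only [hw, Finset.sum_mul, Finset.mul_sum]
    rw [Finset.sum_comm]
    refine Finset.sum_congr rfl fun k _ => Finset.sum_congr rfl fun j _ => by ring
  have h3 : ∑ i, η i * signTensor
      (Fin.cons (α := fun n => Fin (I n) → Bool) (fun k => decide (0 ≤ w k)) σ) i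
      = ∑ k, |w k| := by
    rw [sum_multiIndex_succ]
    refine Finset.sum_congr rfl fun k _ => ?_
    have : ∀ j : MultiIndex (fun n : Fin N => I n.succ), signTensor
        (Fin.cons (α := fun n => Fin (I n) → Bool) (fun k => decide (0 ≤ w k)) σ)
        (Fin.cons (α := fun n => Fin (I n)) k j) =
        (if 0 ≤ w k then 1 else -1) * signTensor σ j := by
      intro j
      simp [signTensor, Fin.prod_univ_succ]
    simp only [this]
    have h4 : ∑ j, η (Fin.cons (α := fun n => Fin (I n)) k j) *
        ((if 0 ≤ w k then 1 else -1) * signTensor σ j) = (if 0 ≤ w k then 1 else -1) * w k := by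
      simp only [hw, Finset.mul_sum]
      refine Finset.sum_congr rfl fun j _ => by ring
    rw [h4]
    split_ifs with h
    · rw [one_mul, abs_of_nonneg h]
    · rw [neg_one_mul, abs_of_neg (not_le.1 h)]
  rw [h1, h3, abs_of_nonneg (a := ∑ k, |w k|) (Finset.sum_nonneg fun k _ => abs_nonneg _)]
  rw [h2] at hσ
  refine hσ.trans ?_
  have h5 : |∑ k, u k * w k| ≤ c * ∑ k, |w k| := by
    rw [Finset.mul_sum]
    refine (Finset.abs_sum_le_sum_abs _ _).trans (Finset.sum_le_sum fun k _ => ?_)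
    rw [abs_mul]
    exact mul_le_mul_of_nonneg_right (hu k) (abs_nonneg _)
  calc ρ * |∑ k, u k * w k| ≤ ρ * (c * ∑ k, |w k|) := by gcongr
    _ = _ := by ring

theorem isSignBounded_of_no_modes {I : Fin 0 → ℕ} (T : RTensor I) {c : ℝ} (hT : ∀ i, |T i| ≤ c) :
    IsSignBounded c T := fun η => by
  refine ⟨fun n => n.elim0, ?_⟩
  simp only [Finset.univ_unique, Finset.sum_singleton, signTensor, Finset.univ_eq_empty,
    Finset.prod_empty, mul_one, abs_mul]
  rw [mul_comm]
  exact mul_le_mul_of_nonneg_right (hT _) (abs_nonneg _)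

theorem isSignBounded_prod : ∀ {N : ℕ} {I : Fin N → ℕ} (u : (n : Fin N) → Fin (I n) → ℝ)
    (_ : ∀ n k, |u n k| ≤ 1), IsSignBounded (I := I) 1 (fun i => ∏ n, u n (i n))
  | 0, I, u, _ => isSignBounded_of_no_modes _ (by simp)
  | N + 1, I, u, hu => by
    have := IsSignBounded.cons zero_le_one (hu 0)
      (isSignBounded_prod (fun n : Fin N => u n.succ) fun n k => hu n.succ k)
    simpa [Fin.prod_univ_succ] using this

/-- A rank-one tensor with nonnegative factors lies in the hull scaled by its largest entry. -/
theorem isSignBounded_prod_of_nonneg {N : ℕ} {I : Fin N → ℕ} [Nonempty (MultiIndex I)]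
    (a : (n : Fin N) → Fin (I n) → ℝ) (ha : ∀ n k, 0 ≤ a n k) {c : ℝ}
    (hc : ∀ i : MultiIndex I, ∏ n, a n (i n) ≤ c) :
    IsSignBounded (I := I) c (fun i => ∏ n, a n (i n)) := by
  obtain ⟨i₀⟩ := ‹Nonempty (MultiIndex I)›
  have hmax : ∀ n, ∃ k, ∀ l, a n l ≤ a n k := fun n =>
    haveI : Nonempty (Fin (I n)) := ⟨i₀ n⟩
    Finite.exists_max (a n)
  choose k hk using hmax
  -- By nonnegativity the largest entry is attained mode by mode, so `A` is itself an entry of the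
  -- tensor and is at most `c`.
  set A := ∏ n, a n (k n) with hA
  have hA0 : 0 ≤ A := Finset.prod_nonneg fun n _ => ha n _
  have hmain := isSignBounded_prod (I := I) (fun n l => a n l / a n (k n)) (fun n l => by
    rw [abs_of_nonneg (div_nonneg (ha _ _) (ha _ _))]
    exact div_le_one_of_le₀ (hk n l) (ha _ _))
  have hT : ∀ i : MultiIndex I, ∏ n, a n (i n) = A * ∏ n, a n (i n) / a n (k n) := by
    intro i
    rw [hA, ← Finset.prod_mul_distrib]
    refine Finset.prod_congr rfl fun n _ => ?_
    -- If the maximum of a mode vanishes, so does the whole factor, and 0 / 0 = 0 keeps the identity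
    -- true.
    rcases eq_or_ne (a n (k n)) 0 with h | h
    · have := le_antisymm ((hk n (i n)).trans h.le) (ha n _)
      rw [this, h]; simp
    · rw [mul_div_cancel₀ _ h]
  have hAb : IsSignBounded (I := I) A (fun i => ∏ n, a n (i n)) := fun η => by
    obtain ⟨σ, hσ⟩ := hmain η
    refine ⟨σ, ?_⟩
    have : ∑ i, η i * ∏ n, a n (i n) = A * ∑ i, η i * ∏ n, a n (i n) / a n (k n) := by
      rw [Finset.mul_sum]
      refine Finset.sum_congr rfl fun i _ => ?_
      rw [hT i]; ring
    rw [this, abs_mul, abs_of_nonneg hA0]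
    rw [one_mul] at hσ
    gcongr
  exact hAb.mono (hc k)

/-- Every finite family of vectors has a subfamily, of size the dimension of its span, in which
all its members have coefficients of absolute value at most one. -/
theorem exists_subfamily_coeff_le_one {κ W : Type*} [Finite κ] [AddCommGroup W] [Module ℝ W]
    [FiniteDimensional ℝ W] (v : κ → W) :
    ∃ (f : Fin (Module.finrank ℝ (Submodule.span ℝ (Set.range v))) → κ)
      (u : Fin (Module.finrank ℝ (Submodule.span ℝ (Set.range v))) → κ → ℝ),
      (∀ r k, |u r k| ≤ 1) ∧ ∀ k, v k = ∑ r, u r k • v (f r) := by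
  classical
  set V := Submodule.span ℝ (Set.range v)
  let v' : κ → V := fun k => ⟨v k, Submodule.subset_span ⟨k, rfl⟩⟩
  let b := Module.finBasis ℝ V
  -- A basis of the span taken from the family; it shows that the maximal determinant below is
  -- nonzero.
  obtain ⟨g, hg, -, hli⟩ := Submodule.exists_fun_fin_finrank_span_eq ℝ (Set.range v)
  choose f₁ hf₁ using hg
  have : Nonempty (Fin (Module.finrank ℝ V) → κ) := ⟨f₁⟩
  -- As in Auerbach's lemma: by Cramer's rule a coefficient is the ratio of the determinant after
  -- one replacement to the maximal one, hence at most 1 in absolute value.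
  obtain ⟨f, hf⟩ := Finite.exists_max (fun f : Fin (Module.finrank ℝ V) → κ => |b.det (v' ∘ f)|)
  have hne : b.det (v' ∘ f) ≠ 0 := by
    have h1 : LinearIndependent ℝ (v' ∘ f₁) := by
      refine LinearIndependent.of_comp V.subtype ?_
      rw [show V.subtype ∘ v' ∘ f₁ = g from funext hf₁]
      exact hli
    have h2 := (Module.Basis.is_basis_iff_det b).1
      ⟨h1, h1.span_eq_top_of_card_eq_finrank' (Fintype.card_fin _)⟩
    have h3 := hf f₁
    intro h0
    rw [h0, abs_zero] at h3
    exact h2.ne_zero (abs_nonpos_iff.1 h3)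
  obtain ⟨hli', hsp⟩ := (Module.Basis.is_basis_iff_det b).2 (isUnit_iff_ne_zero.2 hne)
  let e := Module.Basis.mk hli' hsp.ge
  have he : ∀ r, e r = v' (f r) := fun r => by simp [e]
  have hcoe : (e : Fin (Module.finrank ℝ V) → V) = v' ∘ f := funext he
  have hdet : ∀ (w : V) r, b.det (Function.update (v' ∘ f) r w) = e.repr w r * b.det (v' ∘ f) := by
    intro w r
    have hw := e.sum_repr w
    conv_lhs => rw [← hw]
    rw [AlternatingMap.map_update_sum, Finset.sum_eq_single r]
    · rw [AlternatingMap.map_update_smul, he r]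
      have : Function.update (v' ∘ f) r (v' (f r)) = v' ∘ f := Function.update_eq_self r (v' ∘ f)
      rw [this, smul_eq_mul]
    · intro j _ hj
      rw [AlternatingMap.map_update_smul, he j]
      have : b.det (Function.update (v' ∘ f) r ((v' ∘ f) j)) = 0 :=
        AlternatingMap.map_update_self _ _ hj.symm
      rw [Function.comp_apply] at this
      rw [this, smul_zero]
    · simp
  refine ⟨f, fun r k => e.repr (v' k) r, fun r k => ?_, fun k => ?_⟩
  · have h1 := hf (Function.update f r k)
    have h2 : v' ∘ Function.update f r k = Function.update (v' ∘ f) r (v' k) :=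
      Function.comp_update v' f r k
    simp only [h2, hdet, abs_mul] at h1
    have h3 : 0 < |b.det (v' ∘ f)| := abs_pos.2 hne
    exact le_of_mul_le_mul_right (by simpa using h1) h3
  · have h1 := congrArg V.subtype (e.sum_repr (v' k))
    rw [map_sum] at h1
    simp only [map_smul, he] at h1
    exact h1.symm

/-- A tensor of rank `R` with entries bounded by `α` lies in the hull scaled by `R ^ (N - 1) α`. -/
theorem isSignBounded_of_rank : ∀ {N : ℕ} {I : Fin (N + 1) → ℕ} {T : RTensor I} {R : ℕ} {α : ℝ}
    (_ : 0 ≤ α) (_ : ∀ i, |T i| ≤ α) (c : Fin R → ℝ) (a : Fin R → (n : Fin (N + 1)) → Fin (I n) → ℝ)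
    (_ : ∀ i, T i = ∑ r, c r * ∏ n, a r n (i n)), IsSignBounded ((R : ℝ) ^ N * α) T
  | 0, I, T, R, α, hα, hT, c, a, h => by
    -- A single mode costs no factor R: the vector itself is bounded by α.
    have h1 := IsSignBounded.cons (I := I) zero_le_one
      (u := fun k => T (Fin.cons (α := fun n => Fin (I n)) k fun n => n.elim0)) (c := α)
      (fun k => hT _) (isSignBounded_of_no_modes (fun _ => (1 : ℝ)) (by simp))
    have h2 : (fun i : MultiIndex I => T (Fin.cons (α := fun n => Fin (I n)) (i 0)
        fun n => n.elim0) * (1 : ℝ)) = T := by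
      funext i
      rw [mul_one]
      congr 1
      funext n
      have : n = 0 := Fin.fin_one_eq_zero n
      subst this
      rfl
    rw [h2] at h1
    simpa using h1
  | N + 1, I, T, R, α, hα, hT, c, a, h => by
    let v : Fin (I 0) → RTensor (fun n : Fin (N + 1) => I n.succ) := fun k j =>
      T (Fin.cons (α := fun n => Fin (I n)) k j)
    let w : Fin R → RTensor (fun n : Fin (N + 1) => I n.succ) := fun r j =>
      ∏ n, a r (Fin.succ n) (j n)
    have hv : ∀ k, v k = ∑ r, (c r * a r 0 k) • w r := by
      intro k
      funext j
      simp only [v, w, h, Finset.sum_apply, Pi.smul_apply, smul_eq_mul]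
      refine Finset.sum_congr rfl fun r _ => ?_
      rw [Fin.prod_univ_succ]
      simp [mul_assoc]
    have hd : Module.finrank ℝ (Submodule.span ℝ (Set.range v)) ≤ R := by
      have h1 : Submodule.span ℝ (Set.range v) ≤ Submodule.span ℝ (Set.range w) := by
        rw [Submodule.span_le]
        rintro _ ⟨k, rfl⟩
        rw [hv k]
        exact Submodule.sum_mem _ fun r _ =>
          Submodule.smul_mem _ _ (Submodule.subset_span ⟨r, rfl⟩)
      refine (Submodule.finrank_mono h1).trans ((finrank_range_le_card w).trans ?_)
      simp
    -- At most R first-mode slices generate all the others with coefficients in [-1, 1]. Unlike the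
    -- factors of the decomposition, slices of `T` inherit the entry bound α, so the induction
    -- continues; each mode after the first costs one factor R.
    obtain ⟨f, u, hu, hvf⟩ := exists_subfamily_coeff_le_one v
    -- Fixing the first index turns the first-mode factors into scalars, which the weights `c`
    -- absorb.
    have hslice : ∀ r, IsSignBounded ((R : ℝ) ^ N * α) (v (f r)) := fun r =>
      isSignBounded_of_rank hα (fun j => hT _) (fun s => c s * a s 0 (f r))
        (fun s n => a s n.succ) (fun j => by
          have := congrFun (hv (f r)) j
          simpa [w] using this)
    have hsum := IsSignBounded.sum (I := I) Finset.univ (by positivity) fun r _ =>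
      IsSignBounded.cons (I := I) (by positivity) (fun k => hu r k) (hslice r)
    have hTeq : T = ∑ r, fun i : MultiIndex I => u r (i 0) * v (f r) (fun n => i n.succ) := by
      funext i
      have h1 := congrFun (hvf (i 0)) (fun n => i n.succ)
      have h2 : v (i 0) (fun n => i n.succ) = T i := by
        simp only [v]
        congr 1
        exact Fin.cons_self_tail i
      rw [← h2, h1]
      simp [Finset.sum_apply]
    rw [hTeq]
    refine hsum.mono ?_
    rw [Finset.card_univ, Fintype.card_fin, one_mul, pow_succ']
    have : (Module.finrank ℝ (Submodule.span ℝ (Set.range v)) : ℝ) ≤ R := by exact_mod_cast hd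
    calc _ ≤ (R : ℝ) * ((R : ℝ) ^ N * α) := by gcongr
      _ = _ := by ring

/-! ### Hull radii of the two rank classes. -/

theorem exists_hasCPDecomp_of_cpRank_le {N : ℕ} {I : Fin N → ℕ} {T : RTensor I} {R : ℕ}
    (h : cpRank T ≤ R) : ∃ R₀ ≤ R, HasCPDecomp T R₀ := by
  have h1 : cpRank T < ((R + 1 : ℕ) : ℕ∞) := h.trans_lt (by exact_mod_cast Nat.lt_succ_self R)
  simp only [cpRank, iInf_lt_iff] at h1
  obtain ⟨R₀, hR₀, h2⟩ := h1
  exact ⟨R₀, Nat.lt_succ_iff.1 (by exact_mod_cast h2), hR₀⟩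

theorem exists_hasNNCPDecomp_of_nncpRank_le {N : ℕ} {I : Fin N → ℕ} {T : RTensor I} {R : ℕ}
    (h : nncpRank T ≤ R) : ∃ R₀ ≤ R, HasNNCPDecomp T R₀ := by
  have h1 : nncpRank T < ((R + 1 : ℕ) : ℕ∞) := h.trans_lt (by exact_mod_cast Nat.lt_succ_self R)
  simp only [nncpRank, iInf_lt_iff] at h1
  obtain ⟨R₀, hR₀, h2⟩ := h1
  exact ⟨R₀, Nat.lt_succ_iff.1 (by exact_mod_cast h2), hR₀⟩

/-- Nonnegative terms cannot cancel, so every rank-one term lies entrywise below `T`, hence below α,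
and the radii add up. -/
theorem isSignBounded_of_mem_nncpSpace {N : ℕ} {I : Fin N → ℕ} [Nonempty (MultiIndex I)]
    {R : ℕ} {α β : ℝ} (hα : 0 ≤ α) {T : RTensor I} (hT : T ∈ nncpSpace I R β α) :
    IsSignBounded (R * α) T := by
  obtain ⟨R₀, hR₀, a, ha, h⟩ := exists_hasNNCPDecomp_of_nncpRank_le hT.2
  have h1 := IsSignBounded.sum (I := I) Finset.univ hα fun r _ =>
    isSignBounded_prod_of_nonneg (I := I) (a r) (ha r) (c := α) fun i => by
      refine le_trans ?_ (hT.1 i).2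
      rw [h i]
      exact Finset.single_le_sum (f := fun r => ∏ n, a r n (i n))
        (fun s _ => Finset.prod_nonneg fun n _ => ha s n _) (Finset.mem_univ r)
  have h2 : T = ∑ r, fun i : MultiIndex I => ∏ n, a r n (i n) := by
    funext i; simp [h i, Finset.sum_apply]
  rw [h2]
  refine h1.mono ?_
  rw [Finset.card_univ, Fintype.card_fin]
  gcongr

/-- An empty sum is zero, which β > 0 excludes. This makes the sum of the two rank terms at least 2.
-/
theorem one_le_of_mem_cpSpace {N : ℕ} {I : Fin N → ℕ} [Nonempty (MultiIndex I)]
    {R : ℕ} {α β : ℝ} (hβ : 0 < β) {T : RTensor I} (hT : T ∈ cpSpace I R β α) : 1 ≤ R := by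
  obtain ⟨R₀, hR₀, a, h⟩ := exists_hasCPDecomp_of_cpRank_le hT.2
  rcases Nat.eq_zero_or_pos R₀ with rfl | h0
  · obtain ⟨i⟩ := ‹Nonempty (MultiIndex I)›
    have h1 := h i
    have h2 := (hT.1 i).1
    simp at h1
    linarith
  · omega

theorem one_le_of_mem_nncpSpace {N : ℕ} {I : Fin N → ℕ} [Nonempty (MultiIndex I)]
    {R : ℕ} {α β : ℝ} (hβ : 0 < β) {T : RTensor I} (hT : T ∈ nncpSpace I R β α) : 1 ≤ R := by
  obtain ⟨R₀, hR₀, a, ha, h⟩ := exists_hasNNCPDecomp_of_nncpRank_le hT.2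
  rcases Nat.eq_zero_or_pos R₀ with rfl | h0
  · obtain ⟨i⟩ := ‹Nonempty (MultiIndex I)›
    have h1 := h i
    have h2 := (hT.1 i).1
    simp at h1
    linarith
  · omega

theorem isSignBounded_of_mem_cpSpace {N : ℕ} (hN : 1 ≤ N) {I : Fin N → ℕ}
    {R : ℕ} {α β : ℝ} (hβ : 0 ≤ β) (hα : 0 ≤ α) {T : RTensor I} (hT : T ∈ cpSpace I R β α) :
    IsSignBounded ((R : ℝ) ^ (N - 1) * α) T := by
  obtain ⟨N, rfl⟩ := Nat.exists_eq_add_of_le' hN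
  obtain ⟨R₀, hR₀, a, h⟩ := exists_hasCPDecomp_of_cpRank_le hT.2
  have h1 : ∀ i, |T i| ≤ α := fun i => by
    rw [abs_of_nonneg (hβ.trans (hT.1 i).1)]
    exact (hT.1 i).2
  refine (isSignBounded_of_rank hα h1 (fun _ => 1) a (by simpa using h)).mono ?_
  rw [Nat.add_sub_cancel]
  gcongr

/-! ### Contraction and symmetrization of exponential suprema in one coordinate. -/

theorem exp_sub_exp_le_of_le {b b' δ δ' : ℝ} (hb : b ≤ b') (hδ : 0 ≤ δ) (hδ' : δ ≤ δ') :
    Real.exp (b + δ) - Real.exp b ≤ Real.exp (b' + δ') - Real.exp b' := by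
  have h1 : Real.exp b * (Real.exp δ - 1) ≤ Real.exp b' * (Real.exp δ' - 1) := by
    have : 0 ≤ Real.exp δ - 1 := by
      have := Real.add_one_le_exp δ
      linarith
    gcongr
  rw [Real.exp_add, Real.exp_add]
  linarith

theorem exp_add_exp_le_of_abs_le {x f d : ℝ} (h : |f| ≤ |d|) :
    Real.exp (x + f) + Real.exp (x - f) ≤ Real.exp (x + d) + Real.exp (x - d) := by
  have h1 : ∀ u, Real.exp (x + u) + Real.exp (x - u) = 2 * Real.exp x * Real.cosh u := by
    intro u
    rw [Real.cosh_eq, sub_eq_add_neg, Real.exp_add, Real.exp_add]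
    ring
  rw [h1, h1]
  gcongr
  exact Real.cosh_le_cosh.2 h

/-- The two-point case of the contraction principle for the exponential function. -/
theorem exp_add_exp_contraction {x₁ x₂ f₁ f₂ d₁ d₂ B : ℝ} (h₁ : |f₁| ≤ |d₁|) (h₂ : |f₂| ≤ |d₂|)
    (h₁₂ : |f₁ - f₂| ≤ |d₁ - d₂|)
    (hB₁ : Real.exp (x₁ + d₁) + Real.exp (x₂ - d₂) ≤ B)
    (hB₂ : Real.exp (x₂ + d₂) + Real.exp (x₁ - d₁) ≤ B)
    (hB₃ : Real.exp (x₁ + d₁) + Real.exp (x₁ - d₁) ≤ B)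
    (hB₄ : Real.exp (x₂ + d₂) + Real.exp (x₂ - d₂) ≤ B) :
    Real.exp (x₁ + f₁) + Real.exp (x₂ - f₂) ≤ B := by
  -- If one point has the larger value in both exponentials, the sum at that point alone is larger
  -- and monotonicity of cosh finishes. Otherwise either both terms compare directly or convexity of
  -- exp trades the loss in one for the gain in the other.
  rcases lt_or_ge (x₁ + f₁) (x₂ + f₂) with H1 | H1
  · have := Real.exp_le_exp.2 H1.le
    have := exp_add_exp_le_of_abs_le (x := x₂) h₂
    linarith
  rcases lt_or_ge (x₂ - f₂) (x₁ - f₁) with H2 | H2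
  · have := Real.exp_le_exp.2 H2.le
    have := exp_add_exp_le_of_abs_le (x := x₁) h₁
    linarith
  wlog hpos : 0 ≤ d₁ generalizing d₁ d₂
  · push Not at hpos
    refine this (d₁ := -d₁) (d₂ := -d₂) (by rwa [abs_neg]) (by rwa [abs_neg]) ?_ ?_ ?_ ?_ ?_ ?_
    · rwa [show -d₁ - -d₂ = -(d₁ - d₂) by ring, abs_neg]
    · rw [sub_neg_eq_add, ← sub_eq_add_neg, add_comm]; exact hB₂
    · rw [sub_neg_eq_add, ← sub_eq_add_neg, add_comm]; exact hB₁
    · rw [sub_neg_eq_add, ← sub_eq_add_neg, add_comm]; exact hB₃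
    · rw [sub_neg_eq_add, ← sub_eq_add_neg, add_comm]; exact hB₄
    · linarith
  rw [abs_of_nonneg hpos] at h₁
  have hf₁ := abs_le.1 h₁
  have hf₁₂ := abs_le.1 h₁₂
  rcases le_total d₂ 0 with hd₂ | hd₂
  · rw [abs_of_nonpos hd₂] at h₂
    have hf₂ := abs_le.1 h₂
    have a1 : Real.exp (x₁ + f₁) ≤ Real.exp (x₁ + d₁) := by gcongr; exact hf₁.2
    have a2 : Real.exp (x₂ - f₂) ≤ Real.exp (x₂ - d₂) := by
      apply Real.exp_le_exp.2; linarith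
    linarith
  rw [abs_of_nonneg hd₂] at h₂
  have hf₂ := abs_le.1 h₂
  rcases le_total d₂ d₁ with hd | hd
  · rw [abs_of_nonneg (sub_nonneg.2 hd)] at hf₁₂
    have := exp_sub_exp_le_of_le (b := x₂ - d₂) (b' := x₁ + f₁) (δ := d₂ - f₂) (δ' := d₁ - f₁)
      (by linarith) (by linarith) (by linarith)
    rw [show x₂ - d₂ + (d₂ - f₂) = x₂ - f₂ by ring, show x₁ + f₁ + (d₁ - f₁) = x₁ + d₁ by ring]
      at this
    linarith
  · rw [abs_of_nonpos (sub_nonpos.2 hd)] at hf₁₂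
    have := exp_sub_exp_le_of_le (b := x₁ - d₁) (b' := x₂ - f₂) (δ := d₁ + f₁) (δ' := d₂ + f₂)
      (by linarith) (by linarith) (by linarith)
    rw [show x₁ - d₁ + (d₁ + f₁) = x₁ + f₁ by ring, show x₂ - f₂ + (d₂ + f₂) = x₂ + d₂ by ring]
      at this
    linarith

/-- The supremum over `a` of `exp (u a)`, as an extended nonnegative number. -/
noncomputable def supExp {τ : Type*} (u : τ → ℝ) : ENNReal := ⨆ a, ENNReal.ofReal (Real.exp (u a))

section Contraction

variable {τ : Type*} {A : τ → ℝ}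

theorem le_supExp (u : τ → ℝ) (a : τ) : ENNReal.ofReal (Real.exp (u a)) ≤ supExp u :=
  le_iSup (fun a => ENNReal.ofReal (Real.exp (u a))) a

theorem supExp_add_supExp_le {u v : τ → ℝ} {B : ENNReal}
    (h : ∀ a b, ENNReal.ofReal (Real.exp (u a) + Real.exp (v b)) ≤ B) :
    supExp u + supExp v ≤ B := by
  rcases isEmpty_or_nonempty τ with hτ | hτ
  · simp [supExp]
  · refine ENNReal.iSup_add_iSup_le fun a b => ?_
    rw [← ENNReal.ofReal_add (Real.exp_pos _).le (Real.exp_pos _).le]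
    exact h a b

theorem ofReal_exp_add_exp_le (u v : τ → ℝ) (a b : τ) :
    ENNReal.ofReal (Real.exp (u a) + Real.exp (v b)) ≤ supExp u + supExp v := by
  rw [ENNReal.ofReal_add (Real.exp_pos _).le (Real.exp_pos _).le]
  exact add_le_add (le_supExp u a) (le_supExp v b)

/-- For near-maximizers a and b of the two suprema on the left, the two-point inequality needs the
pairs (a, b), (b, a), (a, a) and (b, b), all dominated by the right side. -/
theorem supExp_contraction {f d : τ → ℝ} (h : ∀ a, |f a| ≤ |d a|)
    (h' : ∀ a b, |f a - f b| ≤ |d a - d b|) :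
    supExp (fun a => A a + f a) + supExp (fun a => A a - f a) ≤
      supExp (fun a => A a + d a) + supExp (fun a => A a - d a) := by
  refine supExp_add_supExp_le fun a b => ?_
  set U := supExp (fun a => A a + d a) + supExp (fun a => A a - d a) with hU
  rcases eq_or_ne U ⊤ with hT | hT
  · rw [hT]; exact le_top
  rw [ENNReal.ofReal_le_iff_le_toReal hT]
  have key : ∀ a b, Real.exp (A a + d a) + Real.exp (A b - d b) ≤ U.toReal := fun a b =>
    (ENNReal.ofReal_le_iff_le_toReal hT).1
      (ofReal_exp_add_exp_le (fun a => A a + d a) (fun a => A a - d a) a b)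
  exact exp_add_exp_contraction (h a) (h b) (h' a b) (key a b) (key b a) (key a a) (key b b)

/-- Convexity of exp. With s and t coming from two independent copies, it decouples them at the
price of doubling the scale. -/
theorem two_mul_supExp_le (s t : ℝ) (d : τ → ℝ) :
    2 * supExp (fun a => A a + (s + t) * d a) ≤
      supExp (fun a => A a + 2 * s * d a) + supExp (fun a => A a + 2 * t * d a) := by
  rw [supExp, ENNReal.mul_iSup]
  refine iSup_le fun a => ?_
  have h1 := ofReal_exp_add_exp_le (fun a => A a + 2 * s * d a) (fun a => A a + 2 * t * d a) a a
  refine le_trans ?_ h1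
  rw [show (2 : ENNReal) = ENNReal.ofReal 2 by simp, ← ENNReal.ofReal_mul (by norm_num)]
  apply ENNReal.ofReal_le_ofReal
  have h2 := two_mul_le_add_sq (Real.exp ((A a + 2 * s * d a) / 2))
    (Real.exp ((A a + 2 * t * d a) / 2))
  rw [mul_assoc, ← Real.exp_add, ← Real.exp_nat_mul, ← Real.exp_nat_mul] at h2
  refine le_trans (le_of_eq ?_) (h2.trans (le_of_eq ?_))
  · congr 2; ring
  · congr 2 <;> push_cast <;> ring

theorem ofReal_integral_le_lintegral_ofReal {X : Type*} [MeasurableSpace X] {ν : Measure X}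
    {f : X → ℝ} (hf : Integrable f ν) :
    ENNReal.ofReal (∫ x, f x ∂ν) ≤ ∫⁻ x, ENNReal.ofReal (f x) ∂ν := by
  have h1 : ∫ x, f x ∂ν ≤ ∫ x, max (f x) 0 ∂ν :=
    integral_mono hf hf.pos_part fun x => le_max_left _ _
  refine (ENNReal.ofReal_le_ofReal h1).trans ?_
  rw [ofReal_integral_eq_lintegral_ofReal hf.pos_part (Filter.Eventually.of_forall fun x =>
    le_max_right _ _)]
  refine lintegral_mono fun x => ?_
  rcases le_total (f x) 0 with h | h
  · simp [max_eq_right h]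
  · simp [max_eq_left h]

/-- Jensen's inequality for the exponential function, without integrability of the exponential. -/
theorem ofReal_exp_integral_le {X : Type*} [MeasurableSpace X] {ν : Measure X}
    [IsProbabilityMeasure ν] {f : X → ℝ} (hf : Integrable f ν) :
    ENNReal.ofReal (Real.exp (∫ x, f x ∂ν)) ≤ ∫⁻ x, ENNReal.ofReal (Real.exp (f x)) ∂ν := by
  set c := ∫ x, f x ∂ν with hc
  have hi : Integrable (fun x => Real.exp c * (1 + (f x - c))) ν :=
    ((integrable_const _).add (hf.sub (integrable_const _))).const_mul _
  have h1 : ∫ x, Real.exp c * (1 + (f x - c)) ∂ν = Real.exp c := by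
    rw [integral_const_mul, integral_add (g := fun x => f x - c) (integrable_const _)
      (hf.sub (integrable_const _)), integral_sub hf (integrable_const _)]
    simp [hc]
  rw [← h1]
  refine (ofReal_integral_le_lintegral_ofReal hi).trans (lintegral_mono fun x => ?_)
  apply ENNReal.ofReal_le_ofReal
  have h2 := Real.add_one_le_exp (f x - c)
  calc Real.exp c * (1 + (f x - c)) ≤ Real.exp c * Real.exp (f x - c) := by gcongr; linarith
    _ = Real.exp (f x) := by rw [← Real.exp_add]; ring_nf

/-- Symmetrization and contraction in one coordinate. -/
theorem two_mul_lintegral_supExp_le {ν : Measure ℕ} [IsProbabilityMeasure ν] {Z : ℕ → τ → ℝ}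
    {d : τ → ℝ} {L : ℕ → ℝ} (hL : ∀ y, 0 ≤ L y) (hint : ∀ a, Integrable (fun y => Z y a) ν)
    (hZ : ∀ y a, |Z y a| ≤ L y * |d a|) (hZ' : ∀ y a b, |Z y a - Z y b| ≤ L y * |d a - d b|) :
    2 * ∫⁻ y, supExp (fun a => A a + (Z y a - ∫ x, Z x a ∂ν)) ∂ν ≤
      ∫⁻ y, (supExp (fun a => A a + 2 * L y * d a) + supExp (fun a => A a - 2 * L y * d a)) ∂ν := by
  set G : ℕ → ℕ → ENNReal := fun y x => supExp (fun a => A a + (Z y a - Z x a)) with hG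
  set F : ℕ → ENNReal := fun y =>
    supExp (fun a => A a + 2 * L y * d a) + supExp (fun a => A a - 2 * L y * d a) with hF
  -- Jensen's inequality replaces the mean by an independent copy x.
  have h1 : ∫⁻ y, supExp (fun a => A a + (Z y a - ∫ x, Z x a ∂ν)) ∂ν ≤ ∫⁻ y, ∫⁻ x, G y x ∂ν ∂ν := by
    refine lintegral_mono fun y => iSup_le fun a => ?_
    have hi : Integrable (fun x => A a + (Z y a - Z x a)) ν :=
      (integrable_const _).add ((integrable_const _).sub (hint a))
    have h2 : A a + (Z y a - ∫ x, Z x a ∂ν) = ∫ x, (A a + (Z y a - Z x a)) ∂ν := by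
      rw [integral_add (g := fun x => Z y a - Z x a) (integrable_const _)
        ((integrable_const _).sub (hint a)), integral_sub (integrable_const _) (hint a)]
      simp
    simp only [h2]
    exact (ofReal_exp_integral_le hi).trans
      (lintegral_mono fun x => le_supExp (fun a => A a + (Z y a - Z x a)) a)
  -- Exchanging the copies supplies the opposite sign that contraction requires.
  have h2 : ∫⁻ y, ∫⁻ x, G y x ∂ν ∂ν = ∫⁻ y, ∫⁻ x, G x y ∂ν ∂ν :=
    lintegral_lintegral_swap Measurable.of_discrete.aemeasurable
  have h3 : ∀ y x, 2 * (G y x + G x y) ≤ F y + F x := by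
    intro y x
    have h4 : G y x + G x y ≤ supExp (fun a => A a + (L y + L x) * d a) +
        supExp (fun a => A a - (L y + L x) * d a) := by
      have h5 := supExp_contraction (A := A) (f := fun a => Z y a - Z x a)
        (d := fun a => (L y + L x) * d a) (fun a => ?_) (fun a b => ?_)
      · refine le_trans (le_of_eq ?_) h5
        simp only [hG]
        congr 2
        funext a; ring
      · rw [abs_mul, abs_of_nonneg (add_nonneg (hL y) (hL x)), add_mul]
        exact (abs_sub _ _).trans (add_le_add (hZ y a) (hZ x a))
      · rw [← mul_sub, abs_mul, abs_of_nonneg (add_nonneg (hL y) (hL x)), add_mul]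
        rw [show Z y a - Z x a - (Z y b - Z x b) = (Z y a - Z y b) - (Z x a - Z x b) by ring]
        exact (abs_sub _ _).trans (add_le_add (hZ' y a b) (hZ' x a b))
    have h5 := two_mul_supExp_le (A := A) (L y) (L x) d
    have h6 := two_mul_supExp_le (A := A) (L y) (L x) (fun a => -d a)
    simp only [mul_neg, ← sub_eq_add_neg] at h6
    calc 2 * (G y x + G x y) ≤ 2 * (supExp (fun a => A a + (L y + L x) * d a) +
        supExp (fun a => A a - (L y + L x) * d a)) := by gcongr
      _ ≤ F y + F x := by
        rw [mul_add]
        refine (add_le_add h5 h6).trans (le_of_eq ?_)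
        simp only [hF]
        rw [add_add_add_comm]
  have h4 : 2 * (∫⁻ y, ∫⁻ x, G y x ∂ν ∂ν + ∫⁻ y, ∫⁻ x, G x y ∂ν ∂ν) ≤ 2 * ∫⁻ y, F y ∂ν := by
    rw [← lintegral_add_left Measurable.of_discrete, ← lintegral_const_mul _ Measurable.of_discrete]
    calc _ ≤ ∫⁻ y, ∫⁻ x, (F y + F x) ∂ν ∂ν := by
          refine lintegral_mono fun y => ?_
          rw [← lintegral_add_left Measurable.of_discrete,
            ← lintegral_const_mul _ Measurable.of_discrete]
          exact lintegral_mono fun x => h3 y x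
      _ = 2 * ∫⁻ y, F y ∂ν := by
          simp only [lintegral_add_left Measurable.of_discrete, lintegral_const, measure_univ,
            mul_one, two_mul]
  rw [← h2, ← two_mul] at h4
  have h5 := (ENNReal.mul_le_mul_iff_right (by norm_num) (by norm_num)).1 h4
  exact le_trans (by gcongr) h5

end Contraction

/-! ### Symmetrization over all coordinates. -/

/-- The law of a count with a random sign. -/
noncomputable def signedLaw (ν : Measure ℕ) : Measure ℤ :=
  (2⁻¹ : ENNReal) • (ν.map (fun y : ℕ => (y : ℤ)) + ν.map (fun y : ℕ => -(y : ℤ)))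

theorem lintegral_signedLaw (ν : Measure ℕ) (f : ℤ → ENNReal) :
    ∫⁻ z, f z ∂signedLaw ν = 2⁻¹ * ∫⁻ y, (f y + f (-y)) ∂ν := by
  rw [signedLaw, lintegral_smul_measure, lintegral_add_measure,
    lintegral_map Measurable.of_discrete Measurable.of_discrete,
    lintegral_map Measurable.of_discrete Measurable.of_discrete,
    lintegral_add_left Measurable.of_discrete]
  rfl

instance (ν : Measure ℕ) [IsProbabilityMeasure ν] : IsProbabilityMeasure (signedLaw ν) := by
  constructor
  have := lintegral_signedLaw ν (fun _ => 1)
  rw [lintegral_one] at this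
  rw [this]
  simp only [lintegral_const, measure_univ, mul_one]
  rw [one_add_one_eq_two, ENNReal.inv_mul_cancel] <;> norm_num

/-- Puts the original and the symmetrized process on one space, so that coordinates can be exchanged
one at a time. -/
theorem measurePreserving_natAbs_signedLaw (ν : Measure ℕ) :
    MeasurePreserving Int.natAbs (signedLaw ν) ν := by
  refine ⟨Measurable.of_discrete, ?_⟩
  refine Measure.ext_of_lintegral _ fun f hf => ?_
  rw [lintegral_map hf Measurable.of_discrete, lintegral_signedLaw]
  simp only [Int.natAbs_natCast, Int.natAbs_neg, ← two_mul]
  rw [lintegral_const_mul _ hf, ← mul_assoc, ENNReal.inv_mul_cancel (by norm_num) (by norm_num),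
    one_mul]

/-- Replacing coordinates one by one. -/
theorem lintegral_pi_le_of_hybrid {ι X : Type*} [Fintype ι] [DecidableEq ι] [MeasurableSpace X]
    [Countable X] [MeasurableSingletonClass X] (μ : ι → Measure X) [∀ i, SigmaFinite (μ i)]
    (F : Finset ι → (ι → X) → ENNReal)
    (h : ∀ s j, j ∉ s → ∀ x, ∫⁻ y, F s (Function.update x j y) ∂μ j ≤
      ∫⁻ y, F (insert j s) (Function.update x j y) ∂μ j) :
    ∫⁻ x, F ∅ x ∂Measure.pi μ ≤ ∫⁻ x, F Finset.univ x ∂Measure.pi μ := by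
  suffices H : ∀ s : Finset ι, ∫⁻ x, F ∅ x ∂Measure.pi μ ≤ ∫⁻ x, F s x ∂Measure.pi μ from H _
  intro s
  induction s using Finset.induction_on with
  | empty => exact le_rfl
  | insert j s hj ih =>
    refine ih.trans (lintegral_le_of_lmarginal_le {j} Measurable.of_discrete
      Measurable.of_discrete ?_)
    rw [lmarginal_singleton, lmarginal_singleton]
    exact fun x => h s j hj x

/-- Symmetrization and contraction for a sum over independent coordinates. -/
theorem lintegral_supExp_sum_le {ι τ : Type*} [Fintype ι] [DecidableEq ι] (ν : ι → Measure ℕ)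
    [∀ i, IsProbabilityMeasure (ν i)] {Z : ι → ℕ → τ → ℝ} {d : ι → τ → ℝ} {l : ℝ} (hl : 0 ≤ l)
    (hint : ∀ i a, Integrable (fun y => Z i y a) (ν i))
    (hZ : ∀ i y a, |Z i y a| ≤ l * y * |d i a|)
    (hZ' : ∀ i y a b, |Z i y a - Z i y b| ≤ l * y * |d i a - d i b|) :
    ∫⁻ y, supExp (fun a => ∑ i, (Z i (y i) a - ∫ x, Z i x a ∂ν i)) ∂Measure.pi ν ≤
      ∫⁻ z, supExp (fun a => ∑ i, 2 * l * (z i : ℝ) * d i a)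
        ∂Measure.pi (fun i => signedLaw (ν i)) := by
  have hmp := measurePreserving_pi (fun i => signedLaw (ν i)) ν
    (fun i => measurePreserving_natAbs_signedLaw (ν i))
  rw [← hmp.lintegral_comp Measurable.of_discrete]
  -- Hybrid process: the coordinates in `s` are already linear and signed, the others are still
  -- centred likelihood terms depending on the absolute value only.
  set F : Finset ι → (ι → ℤ) → ENNReal := fun s z => supExp (fun a => ∑ i,
    if i ∈ s then 2 * l * (z i : ℝ) * d i a else Z i (z i).natAbs a - ∫ x, Z i x a ∂ν i) with hF
  have h := lintegral_pi_le_of_hybrid (fun i => signedLaw (ν i)) F ?_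
  · simpa [hF] using h
  intro s j hj x
  set A : τ → ℝ := fun a => ∑ i ∈ Finset.univ.erase j,
    if i ∈ s then 2 * l * (x i : ℝ) * d i a else Z i (x i).natAbs a - ∫ y, Z i y a ∂ν i with hA
  have h1 : ∀ z : ℤ, F s (Function.update x j z) =
      supExp (fun a => A a + (Z j z.natAbs a - ∫ y, Z j y a ∂ν j)) := by
    intro z
    simp only [hF]
    congr 1
    funext a
    rw [← Finset.sum_erase_add _ _ (Finset.mem_univ j), if_neg hj, Function.update_self]
    congr 1
    refine Finset.sum_congr rfl fun i hi => ?_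
    rw [Function.update_of_ne (Finset.ne_of_mem_erase hi)]
  have h2 : ∀ z : ℤ, F (insert j s) (Function.update x j z) =
      supExp (fun a => A a + 2 * l * (z : ℝ) * d j a) := by
    intro z
    simp only [hF]
    congr 1
    funext a
    rw [← Finset.sum_erase_add _ _ (Finset.mem_univ j), if_pos (Finset.mem_insert_self j s),
      Function.update_self]
    congr 1
    refine Finset.sum_congr rfl fun i hi => ?_
    have hne := Finset.ne_of_mem_erase hi
    rw [Function.update_of_ne hne]
    simp [Finset.mem_insert, hne]
  simp only [h1, h2, lintegral_signedLaw, Int.natAbs_natCast, Int.natAbs_neg, ← two_mul]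
  rw [lintegral_const_mul _ Measurable.of_discrete]
  gcongr 2⁻¹ * ?_
  refine (two_mul_lintegral_supExp_le (A := A) (Z := Z j) (d := d j) (L := fun y => l * y)
    (fun y => by positivity) (hint j) (hZ j) (hZ' j)).trans (le_of_eq ?_)
  refine lintegral_congr fun y => ?_
  congr 2
  · funext a; push_cast; ring
  · funext a; push_cast; ring

theorem lintegral_pi_prod_eq {ι X : Type*} [Fintype ι] [DecidableEq ι] [MeasurableSpace X]
    [Countable X] [MeasurableSingletonClass X] (μ : ι → Measure X) [∀ i, IsProbabilityMeasure (μ i)]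
    (f : ι → X → ENNReal) :
    ∫⁻ x, ∏ i, f i (x i) ∂Measure.pi μ = ∏ i, ∫⁻ y, f i y ∂μ i := by
  have h1 : iIndepFun (fun i (x : ι → X) => f i (x i)) (Measure.pi μ) :=
    iIndepFun_pi (X := f) fun i => Measurable.of_discrete.aemeasurable
  rw [lintegral_prod_eq_prod_lintegral_of_indepFun _ _ h1 fun i => Measurable.of_discrete]
  refine Finset.prod_congr rfl fun i _ => ?_
  exact (measurePreserving_eval μ i).lintegral_comp (f := f i) Measurable.of_discrete

/-! ### Moments of Poisson and thinned Poisson counts. -/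

section Poisson

theorem hasSum_mul_poisson (r : NNReal) :
    HasSum (fun n : ℕ => Real.exp (-r) * r ^ n / (n.factorial : ℝ) * n) r := by
  have h := (hasSum_one_poissonMeasure r).mul_left (r : ℝ)
  rw [← hasSum_nat_add_iff' 1]
  simp only [Finset.range_one, Finset.sum_singleton, Nat.cast_zero, mul_zero, sub_zero]
  rw [mul_one] at h
  refine h.congr_fun fun n => ?_
  rw [Nat.factorial_succ]
  push_cast
  have : (n.factorial : ℝ) ≠ 0 := by positivity
  have : (n : ℝ) + 1 ≠ 0 := by positivity
  field_simp
  ring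

theorem integrable_natCast_poissonMeasure (r : NNReal) :
    Integrable (fun n : ℕ => (n : ℝ)) (poissonMeasure r) := by
  rw [integrable_poissonMeasure_iff]
  simpa using (hasSum_mul_poisson r).summable

theorem integral_natCast_poissonMeasure (r : NNReal) :
    ∫ n : ℕ, (n : ℝ) ∂poissonMeasure r = r := by
  rw [integral_poissonMeasure]
  exact (hasSum_mul_poisson r).tsum_eq

theorem integrable_ztpTerm (r : NNReal) (t : ℝ) :
    Integrable (fun n => ztpTerm n t) (poissonMeasure r) := by
  refine ((integrable_natCast_poissonMeasure r).mul_const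
    (|Real.log t| + |Real.log (Real.exp t - 1)|)).mono' Measurable.of_discrete.aestronglyMeasurable
    (Filter.Eventually.of_forall fun n => ?_)
  rcases Nat.eq_zero_or_pos n with rfl | hn
  · simp [ztpTerm]
  · have h1 : (1 : ℝ) ≤ n := by exact_mod_cast hn
    rw [ztpTerm, if_neg hn.ne', Real.norm_eq_abs]
    refine (abs_sub _ _).trans ?_
    rw [abs_mul, Nat.abs_cast, mul_add]
    gcongr
    exact le_mul_of_one_le_left (abs_nonneg _) h1

theorem integral_ztpTerm (r : NNReal) (t : ℝ) :
    ∫ n, ztpTerm n t ∂poissonMeasure r =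
      r * Real.log t - (1 - Real.exp (-r)) * Real.log (Real.exp t - 1) := by
  have h0 : (poissonMeasure r).real {0} = Real.exp (-r) := by
    rw [poissonMeasure_real_singleton]; simp
  rw [measureReal_def] at h0
  have h1 : (fun n => ztpTerm n t) = fun n : ℕ => (n : ℝ) * Real.log t -
      ((1 - Set.indicator {0} (fun _ => (1 : ℝ)) n) * Real.log (Real.exp t - 1)) := by
    funext n
    rcases Nat.eq_zero_or_pos n with rfl | hn
    · simp [ztpTerm]
    · simp [ztpTerm, hn.ne']
  have hi : Integrable (Set.indicator {0} (fun _ => (1 : ℝ))) (poissonMeasure r) :=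
    (integrable_const (1 : ℝ)).indicator (measurableSet_singleton (0 : ℕ))
  rw [h1, integral_sub (g := fun n : ℕ => (1 - Set.indicator {0} (fun _ => (1 : ℝ)) n) *
      Real.log (Real.exp t - 1)) ((integrable_natCast_poissonMeasure r).mul_const _)
    (((integrable_const _).sub hi).mul_const _), integral_mul_const, integral_mul_const,
    integral_sub (integrable_const _) hi, integral_natCast_poissonMeasure,
    integral_indicator (measurableSet_singleton 0)]
  simp [h0]

/-- Exponential tilting: up to a constant the summands are the weights of the Poisson law with
parameter r e^s. -/
theorem lintegral_exp_mul_poissonMeasure (r : NNReal) (s : ℝ) :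
    ∫⁻ n : ℕ, ENNReal.ofReal (Real.exp (s * n)) ∂poissonMeasure r =
      ENNReal.ofReal (Real.exp (r * (Real.exp s - 1))) := by
  obtain ⟨u, hu⟩ : ∃ u : NNReal, (u : ℝ) = Real.exp s :=
    ⟨(Real.exp s).toNNReal, Real.coe_toNNReal _ (Real.exp_pos s).le⟩
  have h := (hasSum_one_poissonMeasure (r * u)).mul_left (Real.exp (r * (Real.exp s - 1)))
  rw [mul_one] at h
  have h1 : ∀ n : ℕ, ENNReal.ofReal (Real.exp (-r) * r ^ n / (n.factorial : ℝ)) *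
      ENNReal.ofReal (Real.exp (s * n)) = ENNReal.ofReal (Real.exp (r * (Real.exp s - 1)) *
      (Real.exp (-(r * u : NNReal)) * (r * u : NNReal) ^ n / (n.factorial : ℝ))) := by
    intro n
    rw [← ENNReal.ofReal_mul (by positivity)]
    congr 1
    have e1 : Real.exp (s * n) = Real.exp s ^ n := by rw [← Real.exp_nat_mul]; ring_nf
    have e2 : Real.exp (r * (Real.exp s - 1)) * Real.exp (-(r * Real.exp s)) = Real.exp (-r) := by
      rw [← Real.exp_add]; ring_nf
    rw [NNReal.coe_mul, hu, e1, mul_pow, ← e2]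
    ring
  rw [poissonMeasure, lintegral_sum_measure]
  simp only [lintegral_smul_measure, lintegral_dirac, smul_eq_mul, h1]
  rw [← ENNReal.ofReal_tsum_of_nonneg (fun n => by positivity) h.summable, h.tsum_eq]

/-- The law of a Poisson count that is observed with probability `q` and recorded as zero
otherwise. -/
noncomputable def thinnedPoisson (q m : ℝ) : Measure ℕ :=
  ENNReal.ofReal (1 - q) • Measure.dirac 0 + ENNReal.ofReal q • poissonMeasure m.toNNReal

theorem isProbabilityMeasure_thinnedPoisson {q : ℝ} (hq : 0 ≤ q) (hq1 : q ≤ 1) (m : ℝ) :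
    IsProbabilityMeasure (thinnedPoisson q m) := by
  constructor
  simp only [thinnedPoisson, Measure.coe_add, Measure.coe_smul, Pi.add_apply, Pi.smul_apply,
    measure_univ, smul_eq_mul, mul_one]
  rw [← ENNReal.ofReal_add (by linarith) hq]
  simp

theorem integrable_ztpTerm_thinnedPoisson (q m t : ℝ) :
    Integrable (fun n => ztpTerm n t) (thinnedPoisson q m) := by
  refine Integrable.add_measure ?_ ?_
  · exact (integrable_dirac (by simp)).smul_measure ENNReal.ofReal_ne_top
  · exact (integrable_ztpTerm _ t).smul_measure ENNReal.ofReal_ne_top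

theorem integral_ztpTerm_thinnedPoisson {q m : ℝ} (hq : 0 ≤ q) (hm : 0 ≤ m) (t : ℝ) :
    ∫ n, ztpTerm n t ∂thinnedPoisson q m =
      q * (m * Real.log t - (1 - Real.exp (-m)) * Real.log (Real.exp t - 1)) := by
  rw [thinnedPoisson, integral_add_measure
    ((integrable_dirac (by simp)).smul_measure ENNReal.ofReal_ne_top)
    ((integrable_ztpTerm _ t).smul_measure ENNReal.ofReal_ne_top), integral_smul_measure,
    integral_smul_measure, integral_dirac, integral_ztpTerm, ENNReal.toReal_ofReal hq,
    Real.coe_toNNReal m hm]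
  simp [ztpTerm]

/-- Symmetry makes the sign of θ irrelevant, and mixing gives (1 - q) + q (1 + 2 v) = 1 + 2 q v ≤
e^(2 q v). -/
theorem lintegral_exp_signedLaw_thinnedPoisson_le {α q m s θ : ℝ} (hq : 0 ≤ q) (hq1 : q ≤ 1)
    (hm : 0 ≤ m) (hmα : m ≤ α) (hs : 0 ≤ s) (hsα : s * (α + 1) ≤ 1) (hθ : θ = s ∨ θ = -s) :
    ∫⁻ z : ℤ, ENNReal.ofReal (Real.exp (θ * z)) ∂signedLaw (thinnedPoisson q m) ≤
      ENNReal.ofReal (Real.exp (2 * q * (s ^ 2 * (α * (α + 1))))) := by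
  have hsym : ∫⁻ z : ℤ, ENNReal.ofReal (Real.exp (θ * z)) ∂signedLaw (thinnedPoisson q m) =
      2⁻¹ * ∫⁻ y : ℕ, (ENNReal.ofReal (Real.exp (s * y)) + ENNReal.ofReal (Real.exp (-s * y)))
        ∂thinnedPoisson q m := by
    rw [lintegral_signedLaw]
    congr 1
    refine lintegral_congr fun y => ?_
    rcases hθ with rfl | rfl
    · push_cast; rw [mul_neg, neg_mul]
    · push_cast; rw [neg_mul_neg, add_comm]
  have hone : ∀ u : ℝ, ∫⁻ y : ℕ, ENNReal.ofReal (Real.exp (u * y)) ∂thinnedPoisson q m =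
      ENNReal.ofReal (1 - q + q * Real.exp (m * (Real.exp u - 1))) := by
    intro u
    rw [thinnedPoisson, lintegral_add_measure, lintegral_smul_measure, lintegral_smul_measure,
      lintegral_dirac, lintegral_exp_mul_poissonMeasure, Real.coe_toNNReal m hm,
      ENNReal.ofReal_add (by linarith) (by positivity), ENNReal.ofReal_mul hq]
    simp
  rw [hsym, lintegral_add_left Measurable.of_discrete, hone, hone]
  have h1 := poisson_cosh_mgf_le hm hmα hs hsα
  rw [show (2 : ENNReal)⁻¹ = ENNReal.ofReal (1 / 2) by
    rw [one_div, ENNReal.ofReal_inv_of_pos (by norm_num)]; simp]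
  have h1q : 0 ≤ 1 - q := by linarith
  rw [← ENNReal.ofReal_add (by positivity) (by positivity), ← ENNReal.ofReal_mul (by norm_num)]
  apply ENNReal.ofReal_le_ofReal
  have h2 := Real.add_one_le_exp (2 * q * (s ^ 2 * (α * (α + 1))))
  nlinarith

end Poisson

/-! ### Comparison of fixed-size sampling with independent sampling. -/

section Sampling

/-- The mode of the binomial law with mean `p` carries at least the average mass. -/
theorem pow_le_succ_mul_choose_mul {n p : ℕ} (hp : p ≤ n) :
    n ^ n ≤ (n + 1) * (n.choose p * p ^ p * (n - p) ^ (n - p)) := by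
  set B : ℕ → ℕ := fun k => n.choose k * p ^ k * (n - p) ^ (n - k) with hB
  have hsum : n ^ n = ∑ k ∈ Finset.range (n + 1), B k := by
    conv_lhs => rw [show n = p + (n - p) by omega, add_pow, ← show n = p + (n - p) by omega]
    exact Finset.sum_congr rfl fun k _ => by simp only [hB, Nat.cast_id]; ring
  suffices h : ∀ k ≤ n, B k ≤ B p by
    rw [hsum]
    calc _ ≤ ∑ k ∈ Finset.range (n + 1), B p :=
          Finset.sum_le_sum fun k hk => h k (Nat.lt_succ_iff.1 (Finset.mem_range.1 hk))
      _ = _ := by simp [hB]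
  -- For p = n all terms but one vanish; otherwise n - p = c + 1 is positive and consecutive terms
  -- can be compared by their ratio.
  rcases hp.eq_or_lt with rfl | hlt
  · intro k hk
    rcases hk.eq_or_lt with rfl | hk'
    · exact le_rfl
    · simp only [hB, Nat.sub_self]
      rw [zero_pow (by omega)]
      simp
  obtain ⟨c, rfl⟩ := Nat.exists_eq_add_of_lt hlt
  -- The ratio of consecutive terms is at least 1 below p and at most 1 from p on, so the largest of
  -- the n + 1 terms is at p.
  have hrec : ∀ k < p + c + 1, B (k + 1) * ((k + 1) * (c + 1)) = B k * ((p + c + 1 - k) * p) := by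
    intro k hk
    have h1 := Nat.choose_succ_right_eq (p + c + 1) k
    obtain ⟨e, he⟩ := Nat.exists_eq_add_of_lt hk
    have e1 : p + c + 1 - k = e + 1 := by omega
    have e2 : p + c + 1 - (k + 1) = e := by omega
    have e3 : p + c + 1 - p = c + 1 := by omega
    simp only [hB, e1, e2, e3]
    rw [e1] at h1
    calc _ = ((p + c + 1).choose (k + 1) * (k + 1)) * (p ^ (k + 1) * (c + 1) ^ (e + 1)) := by ring
      _ = _ := by rw [h1]; ring
  have hdown : ∀ j ≤ p, B (p - j) ≤ B p := by
    intro j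
    induction j with
    | zero => simp
    | succ j ih =>
      intro hj
      refine le_trans ?_ (ih (by omega))
      have h1 := hrec (p - (j + 1)) (by omega)
      rw [show p - (j + 1) + 1 = p - j by omega] at h1
      have h2 : (p - j) * (c + 1) ≤ (p + c + 1 - (p - (j + 1))) * p := by
        obtain ⟨a, rfl⟩ := Nat.exists_eq_add_of_le hj
        rw [show j + 1 + a - j = a + 1 by omega,
          show j + 1 + a + c + 1 - (j + 1 + a - (j + 1)) = j + c + 2 by omega]
        nlinarith
      have h3 : 0 < (p - j) * (c + 1) := Nat.mul_pos (by omega) (by omega)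
      refine Nat.le_of_mul_le_mul_right ?_ h3
      rw [h1]
      exact Nat.mul_le_mul_left _ h2
  have hup : ∀ j ≤ c + 1, B (p + j) ≤ B p := by
    intro j
    induction j with
    | zero => simp
    | succ j ih =>
      intro hj
      refine le_trans ?_ (ih (by omega))
      have h1 := hrec (p + j) (by omega)
      have h2 : (p + c + 1 - (p + j)) * p ≤ (p + j + 1) * (c + 1) := by
        obtain ⟨a, ha⟩ := Nat.exists_eq_add_of_le hj
        rw [show p + c + 1 - (p + j) = a + 1 by omega, ha]
        nlinarith [Nat.zero_le (p * j), Nat.zero_le (j * j), Nat.zero_le (j * a)]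
      have h3 : 0 < (p + j + 1) * (c + 1) := by positivity
      refine Nat.le_of_mul_le_mul_right ?_ h3
      rw [← add_assoc, h1]
      exact Nat.mul_le_mul_left _ h2
  intro k hk
  rcases le_total k p with h | h
  · have := hdown (p - k) (by omega)
    rwa [show p - (p - k) = k by omega] at this
  · have := hup (k - p) (by omega)
    rwa [show p + (k - p) = k by omega] at this

/-- Each set of size p has at most n + 1 times its probability under independent sampling with rate
p / n. -/
theorem one_div_choose_le {n p : ℕ} (hn : 0 < n) (hp : p ≤ n) :
    1 / (n.choose p : ℝ) ≤
      (n + 1) * (((p : ℝ) / n) ^ p * (1 - (p : ℝ) / n) ^ (n - p)) := by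
  have h := pow_le_succ_mul_choose_mul hp
  have hR : (n : ℝ) ^ n ≤ (n + 1) * (n.choose p * p ^ p * ((n : ℝ) - p) ^ (n - p)) := by
    have : ((n ^ n : ℕ) : ℝ) ≤ (((n + 1) * (n.choose p * p ^ p * (n - p) ^ (n - p)) : ℕ) : ℝ) := by
      exact_mod_cast h
    push_cast [Nat.cast_sub hp] at this
    exact this
  have hn0 : (0 : ℝ) < n := by exact_mod_cast hn
  have hC : (0 : ℝ) < n.choose p := by exact_mod_cast Nat.choose_pos hp
  rw [one_sub_div hn0.ne', div_pow, div_pow, div_mul_div_comm, ← pow_add,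
    Nat.add_sub_cancel' hp, div_le_iff₀ hC, mul_div_assoc', div_mul_eq_mul_div,
    le_div_iff₀ (by positivity)]
  linarith

variable {N : ℕ} {I : Fin N → ℕ} {E : Type*} [MeasurableSpace E] {μ : Measure E} {M : RTensor I}
  {p : ℕ} {Ω : E → Finset (MultiIndex I)} {X : E → MultiIndex I → ℕ}

/-- The observed counts, with zeros recorded off the sampled set. -/
def observedCounts (Ω : E → Finset (MultiIndex I)) (X : E → MultiIndex I → ℕ) (ω : E) :
    MultiIndex I → ℕ :=
  fun i => if i ∈ Ω ω then X ω i else 0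

theorem IsPoissonSample.measurable_observedCounts (hX : IsPoissonSample μ M p Ω X) :
    Measurable (observedCounts Ω X) := by
  refine measurable_pi_lambda _ fun i => ?_
  refine Measurable.ite ?_ (hX.measurable_count i) measurable_const
  have : {ω | i ∈ Ω ω} = ⋃ s ∈ {s : Finset (MultiIndex I) | i ∈ s}, {ω | Ω ω = s} := by
    ext ω; simp
  rw [this]
  exact MeasurableSet.biUnion (Set.to_countable _) fun s _ => hX.measurable_index s

/-- The bound has the shape of one term in the expansion of a product of thinned laws: Poisson
factors on `s`, point masses at zero off `s`. -/
theorem IsPoissonSample.measure_index_inter_le [IsProbabilityMeasure μ]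
    (hX : IsPoissonSample μ M p Ω X) (y : MultiIndex I → ℕ) (s : Finset (MultiIndex I)) :
    μ ({ω | Ω ω = s} ∩ observedCounts Ω X ⁻¹' {y}) ≤
      (if s.card = p then
        ENNReal.ofReal (1 / ((Fintype.card (MultiIndex I)).choose p : ℝ)) else 0) *
      ((∏ i ∈ s, poissonMeasure (M i).toNNReal {y i}) *
        ∏ i ∈ Finset.univ \ s, Measure.dirac (0 : ℕ) {y i}) := by
  have hμ : μ {ω | Ω ω = s} = if s.card = p then
        ENNReal.ofReal (1 / ((Fintype.card (MultiIndex I)).choose p : ℝ)) else 0 := by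
    have := hX.uniform_index s
    rw [← ofReal_measureReal, this]
    split_ifs <;> simp
  by_cases hs : s.card = p
  swap
  · rw [if_neg hs] at hμ ⊢
    rw [zero_mul]
    exact (measure_mono_null Set.inter_subset_left hμ).le
  by_cases hy : ∃ i, i ∉ s ∧ y i ≠ 0
  · obtain ⟨i, hi, hyi⟩ := hy
    have : {ω | Ω ω = s} ∩ observedCounts Ω X ⁻¹' {y} = ∅ := by
      ext ω
      simp only [Set.mem_inter_iff, Set.mem_ofPred_eq, Set.mem_preimage, Set.mem_singleton_iff,
        Set.mem_empty_iff_false, iff_false, not_and]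
      rintro rfl h
      apply hyi
      rw [← h, observedCounts, if_neg hi]
    rw [this, measure_empty]
    exact zero_le
  push Not at hy
  rw [← hμ]
  have h1 : ∏ i ∈ Finset.univ \ s, Measure.dirac (0 : ℕ) {y i} = 1 := by
    refine Finset.prod_eq_one fun i hi => ?_
    rw [hy i (by simpa using hi)]
    simp
  have h2 : ({ω | Ω ω = s} ∩ observedCounts Ω X ⁻¹' {y}) ⊆
      {ω | Ω ω = s} ∩ ⋂ i ∈ (Finset.univ : Finset {i // i ∈ s}), (fun ω => X ω i) ⁻¹' {y i} := by
    rintro ω ⟨h, h'⟩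
    refine ⟨h, ?_⟩
    simp only [Set.mem_iInter, Set.mem_preimage, Set.mem_singleton_iff]
    intro i _
    have h3 := congrFun (Set.mem_singleton_iff.1 h') i
    rw [observedCounts, if_pos (by rw [show Ω ω = s from h]; exact i.2)] at h3
    exact h3
  have h3 := (hX.indep_count s hs).measure_inter_preimage_eq_mul Finset.univ
    (sets := fun i => {y i}) (fun i _ => measurableSet_singleton _)
  refine (measure_mono h2).trans (le_of_eq ?_)
  rw [← cond_mul_eq_inter (hX.measurable_index s), h3, h1, mul_one, mul_comm]
  congr 1
  rw [← Finset.prod_coe_sort s (fun i => poissonMeasure (M i).toNNReal {y i})]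
  refine Finset.prod_congr rfl fun i _ => ?_
  rw [← hX.law_count s hs i i.2, Measure.map_apply (hX.measurable_count i)
    (measurableSet_singleton _)]

/-- Sampling a uniform set of fixed size is dominated by independent sampling, at the price of a
factor linear in the number of indices. -/
theorem IsPoissonSample.measure_preimage_le [IsProbabilityMeasure μ]
    (hX : IsPoissonSample μ M p Ω X) (hn : 0 < Fintype.card (MultiIndex I))
    (hp : p ≤ Fintype.card (MultiIndex I)) (B : Set (MultiIndex I → ℕ)) :
    μ (observedCounts Ω X ⁻¹' B) ≤ ENNReal.ofReal (Fintype.card (MultiIndex I) + 1) *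
      Measure.pi (fun i => thinnedPoisson ((p : ℝ) / Fintype.card (MultiIndex I)) (M i)) B := by
  set n := Fintype.card (MultiIndex I) with hnd
  set q : ℝ := (p : ℝ) / n with hq
  have hn0 : (0 : ℝ) < n := by exact_mod_cast hn
  have hq0 : 0 ≤ q := by positivity
  have hq1 : q ≤ 1 := by
    rw [hq, div_le_one hn0]; exact_mod_cast hp
  have : ∀ i, IsProbabilityMeasure (thinnedPoisson q (M i)) := fun i =>
    isProbabilityMeasure_thinnedPoisson hq0 hq1 (M i)
  have hmeas := hX.measurable_observedCounts
  have hpt : ∀ y, μ.map (observedCounts Ω X) {y} ≤ ENNReal.ofReal (n + 1) *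
      Measure.pi (fun i => thinnedPoisson q (M i)) {y} := by
    intro y
    rw [Measure.map_apply hmeas (measurableSet_singleton _)]
    have h1 : observedCounts Ω X ⁻¹' {y} ⊆
        ⋃ s ∈ (Finset.univ : Finset (Finset (MultiIndex I))),
          ({ω | Ω ω = s} ∩ observedCounts Ω X ⁻¹' {y}) := by
      intro ω hω
      simp only [Set.mem_iUnion]
      exact ⟨Ω ω, Finset.mem_univ _, rfl, hω⟩
    refine (measure_mono h1).trans ((measure_biUnion_finset_le _ _).trans ?_)
    rw [Measure.pi_singleton]
    have h2 : ∀ i, thinnedPoisson q (M i) {y i} =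
        ENNReal.ofReal q * poissonMeasure (M i).toNNReal {y i} +
          ENNReal.ofReal (1 - q) * Measure.dirac (0 : ℕ) {y i} := fun i => by
      rw [add_comm]; rfl
    simp only [h2]
    -- Expanding the product of mixtures recovers the sum over sampled sets, so the comparison is
    -- made set by set.
    rw [Finset.prod_add, Finset.powerset_univ, Finset.mul_sum]
    refine Finset.sum_le_sum fun s _ => ?_
    refine (hX.measure_index_inter_le y s).trans ?_
    rw [Finset.prod_mul_distrib, Finset.prod_mul_distrib, Finset.prod_const, Finset.prod_const,
      mul_mul_mul_comm (ENNReal.ofReal q ^ _), ← mul_assoc (ENNReal.ofReal (n + 1))]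
    refine mul_le_mul_left ?_ _
    split_ifs with hs
    · rw [← Finset.compl_eq_univ_sdiff, Finset.card_compl, hs, ← hnd,
        ← ENNReal.ofReal_pow hq0, ← ENNReal.ofReal_pow (by linarith),
        ← ENNReal.ofReal_mul (by positivity), ← ENNReal.ofReal_mul (by positivity)]
      exact ENNReal.ofReal_le_ofReal (one_div_choose_le hn hp)
    · exact zero_le
  rw [← Measure.map_apply hmeas (Set.to_countable B).measurableSet,
    ← Measure.tsum_indicator_apply_singleton _ B (Set.to_countable B).measurableSet,
    ← Measure.tsum_indicator_apply_singleton (Measure.pi _) B (Set.to_countable B).measurableSet,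
    ← ENNReal.tsum_mul_left]
  refine ENNReal.tsum_le_tsum fun y => ?_
  by_cases hy : y ∈ B
  · simpa [hy] using hpt y
  · simp [hy]

end Sampling

/-! ### Uniform deviation bound over a class of tensors. -/

section MainBound

variable {N : ℕ} {I : Fin N → ℕ}

theorem signTensor_eq_one_or_neg_one (σ : (n : Fin N) → Fin (I n) → Bool) (i : MultiIndex I) :
    signTensor σ i = 1 ∨ signTensor σ i = -1 := by
  unfold signTensor
  refine Finset.prod_induction _ (fun x : ℝ => x = 1 ∨ x = -1) ?_ (Or.inl rfl) fun n _ => ?_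
  · rintro a b (rfl | rfl) (rfl | rfl) <;> simp
  · split_ifs <;> simp

theorem card_signs :
    Fintype.card ((n : Fin N) → Fin (I n) → Bool) = 2 ^ ∑ n, I n := by
  simp [Finset.prod_pow_eq_pow_sum]

/-- The supremum of a linear functional is reached up to ρ at a sign tensor; then e^|x| ≤ e^x +
e^(-x), and summing over all sign tensors removes the choice. -/
theorem supExp_sum_le_of_isSignBounded {τ : Type*} {d : MultiIndex I → τ → ℝ} {ρ l : ℝ}
    (h : ∀ a, IsSignBounded ρ (fun i => d i a)) (z : MultiIndex I → ℤ) :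
    supExp (fun a => ∑ i, 2 * l * (z i : ℝ) * d i a) ≤
      ∑ σ : (n : Fin N) → Fin (I n) → Bool,
        (∏ i, ENNReal.ofReal (Real.exp (2 * l * ρ * signTensor σ i * z i)) +
          ∏ i, ENNReal.ofReal (Real.exp (-(2 * l * ρ * signTensor σ i) * z i))) := by
  have hprod : ∀ w : MultiIndex I → ℝ,
      ∏ i, ENNReal.ofReal (Real.exp (w i)) = ENNReal.ofReal (Real.exp (∑ i, w i)) := by
    intro w
    rw [Real.exp_sum, ENNReal.ofReal_prod_of_nonneg fun i _ => (Real.exp_pos _).le]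
  refine iSup_le fun a => ?_
  obtain ⟨σ, hσ⟩ := h a (fun i => 2 * l * (z i : ℝ))
  refine le_trans ?_ (Finset.single_le_sum (f := fun σ : (n : Fin N) → Fin (I n) → Bool =>
    (∏ i, ENNReal.ofReal (Real.exp (2 * l * ρ * signTensor σ i * z i)) +
          ∏ i, ENNReal.ofReal (Real.exp (-(2 * l * ρ * signTensor σ i) * z i))))
    (fun _ _ => zero_le) (Finset.mem_univ σ))
  simp only [hprod]
  rw [← ENNReal.ofReal_add (Real.exp_pos _).le (Real.exp_pos _).le]
  apply ENNReal.ofReal_le_ofReal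
  set x := ∑ i, 2 * l * (z i : ℝ) * signTensor σ i with hx
  have e1 : ∑ i, 2 * l * ρ * signTensor σ i * (z i : ℝ) = ρ * x := by
    rw [hx, Finset.mul_sum]
    exact Finset.sum_congr rfl fun i _ => by ring
  have e2 : ∑ i, -(2 * l * ρ * signTensor σ i) * (z i : ℝ) = -(ρ * x) := by
    rw [← e1, ← Finset.sum_neg_distrib]
    exact Finset.sum_congr rfl fun i _ => by ring
  rw [e1, e2]
  have h1 := Real.exp_le_exp.2 ((le_abs_self _).trans hσ)
  refine h1.trans ?_
  rcases abs_cases x with ⟨hx', -⟩ | ⟨hx', -⟩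
  · rw [hx']
    linarith [Real.exp_pos (-(ρ * x))]
  · rw [hx', mul_neg]
    linarith [Real.exp_pos (ρ * x)]

theorem lintegral_supExp_le_of_isSignBounded {τ : Type*} {d : MultiIndex I → τ → ℝ}
    {ρ l q α : ℝ} {M : RTensor I} (hρ : 0 ≤ ρ) (hl : 0 ≤ l) (hq : 0 ≤ q) (hq1 : q ≤ 1)
    (hM : ∀ i, 0 ≤ M i) (hMα : ∀ i, M i ≤ α) (hs : 2 * l * ρ * (α + 1) ≤ 1)
    (h : ∀ a, IsSignBounded ρ (fun i => d i a)) :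
    ∫⁻ z, supExp (fun a => ∑ i, 2 * l * (z i : ℝ) * d i a)
        ∂Measure.pi (fun i => signedLaw (thinnedPoisson q (M i))) ≤
      ENNReal.ofReal (2 ^ (∑ n, I n + 1) * Real.exp
        (2 * (Fintype.card (MultiIndex I) * q) * ((2 * l * ρ) ^ 2 * (α * (α + 1))))) := by
  have : ∀ i, IsProbabilityMeasure (thinnedPoisson q (M i)) := fun i =>
    isProbabilityMeasure_thinnedPoisson hq hq1 (M i)
  set v := (2 * l * ρ) ^ 2 * (α * (α + 1)) with hv
  have hterm : ∀ w : MultiIndex I → ℝ, (∀ i, w i = 2 * l * ρ ∨ w i = -(2 * l * ρ)) →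
      ∫⁻ z : MultiIndex I → ℤ, ∏ i, ENNReal.ofReal (Real.exp (w i * z i))
        ∂Measure.pi (fun i => signedLaw (thinnedPoisson q (M i))) ≤
      ENNReal.ofReal (Real.exp (2 * (Fintype.card (MultiIndex I) * q) * v)) := by
    intro w hw
    rw [lintegral_pi_prod_eq (fun i => signedLaw (thinnedPoisson q (M i)))
      (fun i (z : ℤ) => ENNReal.ofReal (Real.exp (w i * z)))]
    calc _ ≤ ∏ i : MultiIndex I, ENNReal.ofReal (Real.exp (2 * q * v)) :=
          Finset.prod_le_prod' fun i _ => lintegral_exp_signedLaw_thinnedPoisson_le hq hq1 (hM i)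
            (hMα i) (by positivity) hs (hw i)
      _ = _ := by
          rw [Finset.prod_const, Finset.card_univ, ← ENNReal.ofReal_pow (Real.exp_pos _).le,
            ← Real.exp_nat_mul]
          ring_nf
  have hsign : ∀ (σ : (n : Fin N) → Fin (I n) → Bool) i,
      2 * l * ρ * signTensor σ i = 2 * l * ρ ∨ 2 * l * ρ * signTensor σ i = -(2 * l * ρ) := by
    intro σ i
    rcases signTensor_eq_one_or_neg_one σ i with h | h <;> simp [h]
  refine (lintegral_mono fun z => supExp_sum_le_of_isSignBounded h z).trans ?_
  rw [lintegral_finsetSum _ fun _ _ => Measurable.of_discrete]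
  calc _ ≤ ∑ σ : (n : Fin N) → Fin (I n) → Bool,
        2 * ENNReal.ofReal (Real.exp (2 * (Fintype.card (MultiIndex I) * q) * v)) := by
        refine Finset.sum_le_sum fun σ _ => ?_
        rw [lintegral_add_left Measurable.of_discrete, two_mul (ENNReal.ofReal _)]
        refine add_le_add (hterm _ (hsign σ))
          (hterm (fun i => -(2 * l * ρ * signTensor σ i)) fun i => ?_)
        rcases hsign σ i with h | h <;> simp [h]
    _ = _ := by
        rw [Finset.sum_const, Finset.card_univ, card_signs, nsmul_eq_mul, ← mul_assoc,
          ENNReal.ofReal_mul (by positivity), pow_succ, ENNReal.ofReal_mul (by positivity),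
          ENNReal.ofReal_pow (by norm_num)]
        simp

theorem card_multiIndex : Fintype.card (MultiIndex I) = ∏ n, I n := by
  simp

theorem prod_le_two_pow_sum : ∏ n, I n ≤ 2 ^ ∑ n, I n := by
  rw [← Finset.prod_pow_eq_pow_sum]
  exact Finset.prod_le_prod' fun n _ => Nat.lt_two_pow_self.le

/-- Of the exponent 6 S, the moment bound uses 2 S. The remaining e^(-4 S) beats 2^(4 S), which
absorbs the domination factor, the number of signed sign tensors and p. -/
theorem union_bound_numeric {n S p : ℕ} (hS : 1 ≤ S) (hp : 1 ≤ p) (hpn : p ≤ n) (hn : n ≤ 2 ^ S)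
    {x : ℝ} (hx : 6 * (S : ℝ) ≤ x) :
    ((n : ℝ) + 1) * (2 ^ (S + 1) * Real.exp (2 * S) * Real.exp (-x)) < 2 / p := by
  have hp0 : (0 : ℝ) < p := by exact_mod_cast hp
  have hn1 : (n : ℝ) + 1 ≤ 2 ^ (S + 1) := by
    have h1 : (n : ℝ) ≤ 2 ^ S := by exact_mod_cast hn
    have h2 : (1 : ℝ) ≤ 2 ^ S := one_le_pow₀ (by norm_num)
    rw [pow_succ]; linarith
  have hp2 : (p : ℝ) ≤ 2 ^ S := by exact_mod_cast hpn.trans hn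
  have he : (2 : ℝ) ^ (4 * S) < Real.exp (4 * S) := by
    rw [show (4 : ℝ) * S = ((4 * S : ℕ) : ℝ) * 1 by push_cast; ring, Real.exp_nat_mul]
    refine pow_lt_pow_left₀ ?_ (by norm_num) (by omega)
    linarith [Real.exp_one_gt_d9]
  have hx' : Real.exp (2 * S) * Real.exp (-x) ≤ Real.exp (-(4 * S)) := by
    rw [← Real.exp_add]
    apply Real.exp_le_exp.2
    linarith
  rw [lt_div_iff₀ hp0]
  calc ((n : ℝ) + 1) * (2 ^ (S + 1) * Real.exp (2 * S) * Real.exp (-x)) * p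
      = ((n : ℝ) + 1) * 2 ^ (S + 1) * p * (Real.exp (2 * S) * Real.exp (-x)) := by ring
    _ ≤ 2 ^ (S + 1) * 2 ^ (S + 1) * 2 ^ S * Real.exp (-(4 * S)) := by gcongr
    _ = 2 * (2 ^ (3 * S + 1) * Real.exp (-(4 * S))) := by ring
    _ ≤ 2 * (2 ^ (4 * S) * Real.exp (-(4 * S))) := by
        gcongr
        · norm_num
        · omega
    _ < 2 * (Real.exp (4 * S) * Real.exp (-(4 * S))) := by gcongr
    _ = 2 := by rw [← Real.exp_add]; simp

theorem ztpLogLik_eq_sum_ztpTerm {E : Type*} (Ω : E → Finset (MultiIndex I))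
    (X : E → MultiIndex I → ℕ) (ω : E) (T : RTensor I) :
    ztpLogLik (nonzeroEntries (Ω ω) (X ω)) (X ω) T =
      ∑ i, ztpTerm (observedCounts Ω X ω i) (T i) := by
  classical
  rw [ztpLogLik, nonzeroEntries, Finset.sum_filter, ← Finset.sum_filter_add_sum_filter_not
    Finset.univ (fun i => i ∈ Ω ω) (fun i => ztpTerm (observedCounts Ω X ω i) (T i))]
  rw [Finset.sum_eq_zero (s := Finset.univ.filter fun i => i ∉ Ω ω), add_zero]
  · simp only [Finset.filter_univ_mem]
    refine Finset.sum_congr rfl fun i hi => ?_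
    rw [observedCounts, if_pos hi, ztpTerm, ite_not]
  · intro i hi
    rw [observedCounts, if_neg (Finset.mem_filter.1 hi).2, ztpTerm, if_pos rfl]

variable {E : Type*} [MeasurableSpace E] {μ : Measure E} [IsProbabilityMeasure μ] {M : RTensor I}
  {p : ℕ} {Ω : E → Finset (MultiIndex I)} {X : E → MultiIndex I → ℕ}

/-- Uniform deviation bound: with high probability no tensor whose difference to `M` lies in the
scaled hull of the sign tensors is both at least as likely as `M` and far from `M`. -/
theorem IsPoissonSample.measure_deviation_lt (hX : IsPoissonSample μ M p Ω X) {α β r : ℝ}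
    (hβ : 0 < β) (hβα : β ≤ α) (hr : 0 < r) (hp : 1 ≤ p) (hpI : p ≤ ∏ n, I n)
    (hS : 1 ≤ ∑ n, I n) (hSp : ∑ n, I n ≤ p) (hM : ∀ i, β ≤ M i ∧ M i ≤ α) (𝒯 : Set (RTensor I))
    (h𝒯 : ∀ T ∈ 𝒯, (∀ i, β ≤ T i ∧ T i ≤ α) ∧ IsSignBounded (α * r) (T - M)) :
    μ (observedCounts Ω X ⁻¹' {y | ∃ T ∈ 𝒯,
      0 ≤ ∑ i, (ztpTerm (y i) (T i) - ztpTerm (y i) (M i)) ∧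
      errorFactor I α β p * r * (β ^ 2 * ∏ n, (I n : ℝ)) ≤ ∑ i, (T i - M i) ^ 2}) <
      ENNReal.ofReal (2 / p) := by
  classical
  set S := ∑ n, I n with hSd
  have hα : 0 < α := hβ.trans_le hβα
  have hp0 : (0 : ℝ) < p := by exact_mod_cast hp
  have hS0 : (0 : ℝ) < S := by exact_mod_cast hS
  set n := Fintype.card (MultiIndex I) with hn
  have hnI : n = ∏ n, I n := card_multiIndex
  have hnI' : (n : ℝ) = ∏ n, (I n : ℝ) := by rw [hnI]; push_cast; rfl
  have hpn : p ≤ n := by rw [hnI]; exact hpI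
  have hn0 : (0 : ℝ) < n := by exact_mod_cast (hp.trans hpn)
  set q : ℝ := (p : ℝ) / n with hq
  have hq0 : 0 ≤ q := by positivity
  have hq1 : q ≤ 1 := by rw [hq, div_le_one hn0]; exact_mod_cast hpn
  have : ∀ i, IsProbabilityMeasure (thinnedPoisson q (M i)) := fun i =>
    isProbabilityMeasure_thinnedPoisson hq0 hq1 (M i)
  set κ := 1 + 1 / β with hκ
  have hκ0 : 0 < κ := by positivity
  set c := (1 - Real.exp (-β)) / (4 * α) with hc
  have hc0 : 0 < c := by
    have : Real.exp (-β) < 1 := by rw [Real.exp_lt_one_iff]; linarith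
    have : 0 < 1 - Real.exp (-β) := by linarith
    positivity
  set g := √(S : ℝ) / √(p : ℝ) with hg
  have hg0 : 0 < g := by positivity
  have hg2 : g ^ 2 = S / p := by
    rw [hg, div_pow, Real.sq_sqrt hS0.le, Real.sq_sqrt hp0.le]
  have hg1 : g ≤ 1 := by
    rw [hg, div_le_one (by positivity)]
    exact Real.sqrt_le_sqrt (by exact_mod_cast hSp)
  -- Chernoff parameter: s (α + 1) = g ≤ 1, as the moment bound requires, while p s² α (α + 1) ≤ S.
  set s := g / (α + 1) with hs
  set ρ := α * r with hρ
  have hρ0 : 0 < ρ := by positivity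
  -- Chosen backwards: the signed process runs at scale 2 l ρ = s, and `l` is the Lipschitz factor t
  -- κ of the likelihood terms scaled by `t`.
  set l := s / (2 * ρ) with hl
  have hl0 : 0 ≤ l := by positivity
  have hls : 2 * l * ρ = s := by rw [hl]; field_simp
  set t := l / κ with ht
  have ht0 : 0 ≤ t := by positivity
  have htl : t * κ = l := by rw [ht]; field_simp
  -- The drop in expected log-likelihood forced on any tensor that is far from `M`.
  set U := q * c * (errorFactor I α β p * r * (β ^ 2 * n)) with hU
  have hUlow : 6 * (S : ℝ) ≤ t * U := by
    have h1 := le_errorFactor_mul I hβ hβα hp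
    have hsum : ∑ n, (I n : ℝ) = S := by rw [hSd]; push_cast; rfl
    rw [hsum, ← hκ, ← hc, ← hg] at h1
    have e1 : t * U = g / (α + 1) / (2 * (α * r)) / κ * (p * r *
        (errorFactor I α β p * (c * β ^ 2))) := by
      rw [ht, hl, hs, hU, hρ, hq]
      field_simp
    rw [e1]
    calc 6 * (S : ℝ) = 6 * p * g ^ 2 := by rw [hg2]; field_simp
      _ = g / (α + 1) / (2 * (α * r)) / κ * (p * r * (12 * α * (α + 1) * κ * g)) := by
        field_simp; ring
      _ ≤ _ := by gcongr
  let Z : MultiIndex I → ℕ → 𝒯 → ℝ := fun i y a =>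
    t * (ztpTerm y (a.1 i) - ztpTerm y (M i))
  have hsym := lintegral_supExp_sum_le (τ := 𝒯) (fun i => thinnedPoisson q (M i)) (Z := Z)
    (d := fun i a => a.1 i - M i) hl0 (fun i a =>
      ((integrable_ztpTerm_thinnedPoisson q (M i) (a.1 i)).sub
        (integrable_ztpTerm_thinnedPoisson q (M i) (M i))).const_mul t)
    (fun i y a => by
      have h1 := abs_ztpTerm_sub_le hβ (hM i).1 ((h𝒯 a.1 a.2).1 i).1 y
      simp only [Z]
      rw [abs_mul, abs_of_nonneg ht0, ← htl]
      calc _ ≤ t * (y * κ * |a.1 i - M i|) := by gcongr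
        _ = _ := by ring)
    (fun i y a b => by
      have h1 := abs_ztpTerm_sub_le hβ ((h𝒯 b.1 b.2).1 i).1 ((h𝒯 a.1 a.2).1 i).1 y
      simp only [Z]
      rw [← mul_sub, abs_mul, abs_of_nonneg ht0, ← htl, sub_sub_sub_cancel_right,
        sub_sub_sub_cancel_right]
      calc _ ≤ t * (y * κ * |a.1 i - b.1 i|) := by gcongr
        _ = _ := by ring)
  have hbound := lintegral_supExp_le_of_isSignBounded (τ := 𝒯) (d := fun i a => a.1 i - M i)
    hρ0.le hl0 hq0 hq1 (fun i => hβ.le.trans (hM i).1) (fun i => (hM i).2)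
    (by rw [hls, hs]; rw [div_mul_cancel₀ _ (by positivity)]; exact hg1)
    (fun a => (h𝒯 a.1 a.2).2)
  have hexp : 2 * (n * q) * ((2 * l * ρ) ^ 2 * (α * (α + 1))) ≤ 2 * S := by
    have e1 : 2 * (n * q) * ((2 * l * ρ) ^ 2 * (α * (α + 1))) = 2 * S * (α / (α + 1)) := by
      rw [hls, hs, hq, div_pow, hg2]
      field_simp
    rw [e1]
    have : α / (α + 1) ≤ 1 := by rw [div_le_one (by positivity)]; linarith
    nlinarith
  set B : Set (MultiIndex I → ℕ) := {y | ∃ T ∈ 𝒯,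
      0 ≤ ∑ i, (ztpTerm (y i) (T i) - ztpTerm (y i) (M i)) ∧
      errorFactor I α β p * r * (β ^ 2 * ∏ n, (I n : ℝ)) ≤ ∑ i, (T i - M i) ^ 2} with hB
  set W : (MultiIndex I → ℕ) → ENNReal := fun y => supExp (fun a : 𝒯 =>
    ∑ i, (Z i (y i) a - ∫ x, Z i x a ∂thinnedPoisson q (M i))) with hW
  -- The likelihood ratio is nonnegative although its mean is at most -U, so the centred process,
  -- scaled by t, reaches t U.
  have hBW : B ⊆ {y | ENNReal.ofReal (Real.exp (t * U)) ≤ W y} := by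
    rintro y ⟨T, hT, hlik, hfar⟩
    refine le_trans ?_ (le_supExp _ (⟨T, hT⟩ : 𝒯))
    apply ENNReal.ofReal_le_ofReal
    apply Real.exp_le_exp.2
    have hint : ∀ i, ∫ x, Z i x ⟨T, hT⟩ ∂thinnedPoisson q (M i) ≤
        -(t * q * c * (T i - M i) ^ 2) := by
      intro i
      have hm0 : 0 ≤ M i := hβ.le.trans (hM i).1
      simp only [Z]
      rw [integral_const_mul, integral_sub (integrable_ztpTerm_thinnedPoisson q (M i) _)
        (integrable_ztpTerm_thinnedPoisson q (M i) _), integral_ztpTerm_thinnedPoisson hq0 hm0,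
        integral_ztpTerm_thinnedPoisson hq0 hm0]
      have h1 := expected_ztp_le hβ (hM i).1 (hM i).2 ((h𝒯 T hT).1 i).1 ((h𝒯 T hT).1 i).2
      have h2 := mul_le_mul_of_nonneg_left h1 (mul_nonneg ht0 hq0)
      rw [← hc] at h2
      linarith
    calc t * U ≤ t * (q * c * ∑ i, (T i - M i) ^ 2) := by
          rw [hU, hnI']
          gcongr
      _ ≤ t * ∑ i, (ztpTerm (y i) (T i) - ztpTerm (y i) (M i)) +
          t * (q * c * ∑ i, (T i - M i) ^ 2) := le_add_of_nonneg_left (mul_nonneg ht0 hlik)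
      _ = ∑ i, (Z i (y i) ⟨T, hT⟩ + t * q * c * (T i - M i) ^ 2) := by
          rw [Finset.sum_add_distrib, Finset.mul_sum, Finset.mul_sum, Finset.mul_sum]
          congr 1
          exact Finset.sum_congr rfl fun i _ => by ring
      _ ≤ _ := Finset.sum_le_sum fun i _ => by linarith [hint i]
  have hmarkov := mul_meas_ge_le_lintegral (μ := Measure.pi fun i => thinnedPoisson q (M i))
    (f := W) Measurable.of_discrete (ENNReal.ofReal (Real.exp (t * U)))
  have hpi : Measure.pi (fun i => thinnedPoisson q (M i)) B ≤
      ENNReal.ofReal (2 ^ (S + 1) * Real.exp (2 * S) * Real.exp (-(t * U))) := by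
    have h1 : ENNReal.ofReal (Real.exp (t * U)) *
        Measure.pi (fun i => thinnedPoisson q (M i)) B ≤
        ENNReal.ofReal (2 ^ (S + 1) * Real.exp (2 * S)) := by
      refine (mul_le_mul_right (measure_mono hBW) _).trans (hmarkov.trans (hsym.trans
        (hbound.trans (ENNReal.ofReal_le_ofReal ?_))))
      gcongr
    have h2 : ENNReal.ofReal (Real.exp (-(t * U))) * ENNReal.ofReal (Real.exp (t * U)) = 1 := by
      rw [← ENNReal.ofReal_mul (Real.exp_pos _).le, ← Real.exp_add]; simp
    calc Measure.pi (fun i => thinnedPoisson q (M i)) B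
        = ENNReal.ofReal (Real.exp (-(t * U))) * (ENNReal.ofReal (Real.exp (t * U)) *
          Measure.pi (fun i => thinnedPoisson q (M i)) B) := by rw [← mul_assoc, h2, one_mul]
      _ ≤ ENNReal.ofReal (Real.exp (-(t * U))) *
          ENNReal.ofReal (2 ^ (S + 1) * Real.exp (2 * S)) := by gcongr
      _ = _ := by rw [← ENNReal.ofReal_mul (Real.exp_pos _).le, mul_comm]
  refine (hX.measure_preimage_le (hp.trans hpn) hpn B).trans_lt ?_
  refine (mul_le_mul_right hpi _).trans_lt ?_
  rw [← ENNReal.ofReal_mul (by positivity), ENNReal.ofReal_lt_ofReal_iff (by positivity)]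
  exact union_bound_numeric hS hp hpn (hnI.le.trans prod_le_two_pow_sum) hUlow

theorem card_mul_sq_le_frobNorm_sq {β : ℝ} (hβ : 0 ≤ β) (hM : ∀ i, β ≤ M i) :
    β ^ 2 * ∏ n, (I n : ℝ) ≤ frobNorm M ^ 2 := by
  have h1 : (∏ n, (I n : ℝ)) = (Fintype.card (MultiIndex I) : ℝ) := by
    rw [card_multiIndex]; push_cast; rfl
  rw [frobNorm, Real.sq_sqrt (Finset.sum_nonneg fun i _ => sq_nonneg _), h1, mul_comm,
    ← nsmul_eq_mul, ← Finset.card_univ]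
  exact Finset.card_nsmul_le_sum _ _ _ fun i _ => by
    have := hM i
    gcongr

theorem frobNorm_sub_sq_le {α β : ℝ} (hβ : 0 ≤ β) {T : RTensor I}
    (hM : ∀ i, β ≤ M i ∧ M i ≤ α) (hT : ∀ i, β ≤ T i ∧ T i ≤ α) :
    frobNorm (M - T) ^ 2 ≤ α ^ 2 * ∏ n, (I n : ℝ) := by
  have h1 : (∏ n, (I n : ℝ)) = (Fintype.card (MultiIndex I) : ℝ) := by
    rw [card_multiIndex]; push_cast; rfl
  rw [frobNorm, Real.sq_sqrt (Finset.sum_nonneg fun i _ => sq_nonneg _), h1, mul_comm,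
    ← nsmul_eq_mul, ← Finset.card_univ]
  exact Finset.sum_le_card_nsmul _ _ _ fun i _ => by
    have h2 := hM i
    have h3 := hT i
    exact sq_le_sq' (by simp only [Pi.sub_apply]; linarith) (by simp only [Pi.sub_apply]; linarith)

theorem IsPoissonSample.lt_measureReal_error_le (hX : IsPoissonSample μ M p Ω X) {α β r : ℝ}
    (hN : 1 ≤ N) (hβ : 0 < β) (hβα : β ≤ α) (hp : 1 ≤ p) (hpI : p ≤ ∏ n, I n)
    (hM : ∀ i, β ≤ M i ∧ M i ≤ α) (𝒯 : Set (RTensor I)) (hr : 𝒯.Nonempty → 2 ≤ r)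
    (h𝒯 : ∀ T ∈ 𝒯, (∀ i, β ≤ T i ∧ T i ≤ α) ∧ IsSignBounded (α * r) (T - M)) :
    1 - 2 / (p : ℝ) < μ.real {ω | ∀ T ∈ 𝒯,
        ztpLogLik (nonzeroEntries (Ω ω) (X ω)) (X ω) M
            ≤ ztpLogLik (nonzeroEntries (Ω ω) (X ω)) (X ω) T →
          frobNorm (M - T) ^ 2 / frobNorm M ^ 2 ≤ errorFactor I α β p * r} := by
  have hp0 : (0 : ℝ) < p := by exact_mod_cast hp
  have htriv : (∀ T ∈ 𝒯, frobNorm (M - T) ^ 2 / frobNorm M ^ 2 ≤ errorFactor I α β p * r) →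
      1 - 2 / (p : ℝ) < μ.real {ω | ∀ T ∈ 𝒯,
        ztpLogLik (nonzeroEntries (Ω ω) (X ω)) (X ω) M
            ≤ ztpLogLik (nonzeroEntries (Ω ω) (X ω)) (X ω) T →
          frobNorm (M - T) ^ 2 / frobNorm M ^ 2 ≤ errorFactor I α β p * r} := by
    intro h
    rw [show {ω | ∀ T ∈ 𝒯, ztpLogLik (nonzeroEntries (Ω ω) (X ω)) (X ω) M
            ≤ ztpLogLik (nonzeroEntries (Ω ω) (X ω)) (X ω) T →
          frobNorm (M - T) ^ 2 / frobNorm M ^ 2 ≤ errorFactor I α β p * r} = Set.univ from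
      Set.eq_univ_of_forall fun ω T hT _ => h T hT, probReal_univ]
    have : 0 < 2 / (p : ℝ) := by positivity
    linarith
  -- For an empty class `r` is not controlled, but the event is certain.
  rcases 𝒯.eq_empty_or_nonempty with rfl | hne
  · exact htriv (by simp)
  have hr2 := hr hne
  have hI : ∀ n, 1 ≤ I n := fun n => by
    have h1 : ∏ n, I n ≠ 0 := by omega
    exact Nat.one_le_iff_ne_zero.2 (Finset.prod_ne_zero_iff.1 h1 n (Finset.mem_univ n))
  have hprod : 0 < ∏ n, (I n : ℝ) := Finset.prod_pos fun n _ => by exact_mod_cast hI n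
  have hMpos : 0 < frobNorm M ^ 2 :=
    lt_of_lt_of_le (by positivity) (card_mul_sq_le_frobNorm_sq hβ.le fun i => (hM i).1)
  -- With p ≤ ∑ I n the bound is deterministic and uses only r ≥ 2.
  rcases le_total p (∑ n, I n) with hpS | hSp
  · refine htriv fun T hT => ?_
    have hpS' : (p : ℝ) ≤ ∑ n, (I n : ℝ) := by exact_mod_cast hpS
    have h1 := sq_div_sq_le_errorFactor_mul_two I hβ hβα hp hpS'
    have h2 : 0 ≤ errorFactor I α β p := by
      have : 0 ≤ α ^ 2 / β ^ 2 := by positivity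
      linarith
    calc frobNorm (M - T) ^ 2 / frobNorm M ^ 2
        ≤ (α ^ 2 * ∏ n, (I n : ℝ)) / (β ^ 2 * ∏ n, (I n : ℝ)) := by
          gcongr
          · exact frobNorm_sub_sq_le hβ.le hM (h𝒯 T hT).1
          · exact card_mul_sq_le_frobNorm_sq hβ.le fun i => (hM i).1
      _ = α ^ 2 / β ^ 2 := by rw [mul_div_mul_right _ _ hprod.ne']
      _ ≤ errorFactor I α β p * 2 := h1
      _ ≤ errorFactor I α β p * r := by gcongr
  have hS : 1 ≤ ∑ n, I n :=
    (hI ⟨0, hN⟩).trans (Finset.single_le_sum (fun n _ => Nat.zero_le _) (Finset.mem_univ _))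
  have hlt := hX.measure_deviation_lt hβ hβα (by linarith) hp hpI hS hSp hM 𝒯 h𝒯
  set B := observedCounts Ω X ⁻¹' {y | ∃ T ∈ 𝒯,
      0 ≤ ∑ i, (ztpTerm (y i) (T i) - ztpTerm (y i) (M i)) ∧
      errorFactor I α β p * r * (β ^ 2 * ∏ n, (I n : ℝ)) ≤ ∑ i, (T i - M i) ^ 2} with hB
  have hBm : MeasurableSet B := hX.measurable_observedCounts (Set.to_countable _).measurableSet
  have hBlt : μ.real B < 2 / p := by
    rw [measureReal_def]
    exact (ENNReal.lt_ofReal_iff_toReal_lt (measure_ne_top μ B)).1 hlt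
  have hBc : μ.real Bᶜ = 1 - μ.real B := probReal_compl_eq_one_sub hBm
  refine lt_of_lt_of_le (by linarith : 1 - 2 / (p : ℝ) < μ.real Bᶜ) (measureReal_mono ?_)
  intro ω hω T hT hlik
  by_contra hcon
  push Not at hcon
  apply hω
  refine ⟨T, hT, ?_, ?_⟩
  · rw [ztpLogLik_eq_sum_ztpTerm, ztpLogLik_eq_sum_ztpTerm] at hlik
    rw [Finset.sum_sub_distrib]
    linarith
  · rw [lt_div_iff₀ hMpos] at hcon
    have h1 : 0 ≤ errorFactor I α β p * r := by
      have h2 := le_errorFactor_mul I hβ hβα hp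
      have h3 : 0 < (1 - Real.exp (-β)) / (4 * α) * β ^ 2 := by
        have : Real.exp (-β) < 1 := by rw [Real.exp_lt_one_iff]; linarith
        have : 0 < 1 - Real.exp (-β) := by linarith
        have : 0 < α := hβ.trans_le hβα
        positivity
      have h4 : 0 ≤ errorFactor I α β p := by
        refine nonneg_of_mul_nonneg_left (le_trans ?_ h2) h3
        have : 0 < α := hβ.trans_le hβα
        positivity
      exact mul_nonneg h4 (by linarith)
    have h2 := mul_le_mul_of_nonneg_left
      (card_mul_sq_le_frobNorm_sq (I := I) hβ.le fun i => (hM i).1) h1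
    have h3 : frobNorm (M - T) ^ 2 = ∑ i, (T i - M i) ^ 2 := by
      rw [frobNorm, Real.sq_sqrt (Finset.sum_nonneg fun i _ => sq_nonneg _)]
      exact Finset.sum_congr rfl fun i _ => by rw [Pi.sub_apply, ← neg_sub, neg_sq]
    linarith

end MainBound

/-! ### Application to the two rank classes. -/

theorem theorem2 {N : ℕ} (hN : 1 ≤ N) (I : Fin N → ℕ)
    (hI : ((N : ℝ) - 1) * Real.logb 2 ((⨆ n, I n : ℕ) : ℝ) ^ 2 + 1 ≤ ((⨅ n, I n : ℕ) : ℝ))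
    (α β : ℝ) (hβ : 0 < β) (hβα : β ≤ α)
    (p : ℕ) (hp : 1 ≤ p) (hpI : p ≤ ∏ n, I n) (R R' : ℕ) (M : RTensor I)
    {E : Type*} [MeasurableSpace E] (μ : Measure E) [IsProbabilityMeasure μ]
    (Ω : E → Finset (MultiIndex I)) (X : E → MultiIndex I → ℕ)
    (hX : IsPoissonSample μ M p Ω X) :
    (M ∈ nncpSpace I R β α →
      1 - 2 / (p : ℝ) < μ.real {ω | ∀ M' ∈ nncpSpace I R' β α,
        ztpLogLik (nonzeroEntries (Ω ω) (X ω)) (X ω) M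
            ≤ ztpLogLik (nonzeroEntries (Ω ω) (X ω)) (X ω) M' →
          frobNorm (M - M') ^ 2 / frobNorm M ^ 2
            ≤ errorFactor I α β p * ((R : ℝ) + R')}) ∧
    (M ∈ cpSpace I R β α →
      1 - 2 / (p : ℝ) < μ.real {ω | ∀ M' ∈ cpSpace I R' β α,
        ztpLogLik (nonzeroEntries (Ω ω) (X ω)) (X ω) M
            ≤ ztpLogLik (nonzeroEntries (Ω ω) (X ω)) (X ω) M' →
          frobNorm (M - M') ^ 2 / frobNorm M ^ 2
            ≤ errorFactor I α β p *
              (((R : ℝ) * √(R : ℝ)) ^ (N - 1) + ((R' : ℝ) * √(R' : ℝ)) ^ (N - 1))}) := by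
  have hprod : 0 < ∏ n, I n := hp.trans hpI
  have : Nonempty (MultiIndex I) := ⟨fun n =>
    ⟨0, Nat.pos_of_ne_zero (Finset.prod_ne_zero_iff.1 hprod.ne' n (Finset.mem_univ n))⟩⟩
  have hα : 0 < α := hβ.trans_le hβα
  constructor
  · intro hM
    have hR : (1 : ℝ) ≤ R := by exact_mod_cast one_le_of_mem_nncpSpace hβ hM
    refine hX.lt_measureReal_error_le hN hβ hβα hp hpI hM.1 (nncpSpace I R' β α) ?_
      fun T hT => ⟨hT.1, ?_⟩
    · rintro ⟨T, hT⟩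
      have hR' : (1 : ℝ) ≤ R' := by exact_mod_cast one_le_of_mem_nncpSpace hβ hT
      linarith
    · rw [sub_eq_add_neg]
      refine ((isSignBounded_of_mem_nncpSpace hα.le hT).add
        (isSignBounded_of_mem_nncpSpace hα.le hM).neg (by positivity) (by positivity)).mono
        (le_of_eq ?_)
      ring
  · intro hM
    -- The hull radius grows only like R^(N-1); the stated (R √R)^(N-1) dominates it since R ≥ 1.
    have hpow : ∀ k : ℕ, 1 ≤ k → (k : ℝ) ≤ k * √(k : ℝ) := fun k hk =>
      le_mul_of_one_le_right (Nat.cast_nonneg k) (Real.one_le_sqrt.2 (by exact_mod_cast hk))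
    have hone : ∀ k : ℕ, 1 ≤ k → 1 ≤ ((k : ℝ) * √(k : ℝ)) ^ (N - 1) := fun k hk =>
      one_le_pow₀ (le_trans (by exact_mod_cast hk) (hpow k hk))
    have hR := one_le_of_mem_cpSpace hβ hM
    refine hX.lt_measureReal_error_le hN hβ hβα hp hpI hM.1 (cpSpace I R' β α) ?_
      fun T hT => ⟨hT.1, ?_⟩
    · rintro ⟨T, hT⟩
      linarith [hone R hR, hone R' (one_le_of_mem_cpSpace hβ hT)]
    · have hR' := one_le_of_mem_cpSpace hβ hT
      have h1 : (R : ℝ) ^ (N - 1) ≤ ((R : ℝ) * √(R : ℝ)) ^ (N - 1) := by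
        gcongr; exact hpow R hR
      have h2 : (R' : ℝ) ^ (N - 1) ≤ ((R' : ℝ) * √(R' : ℝ)) ^ (N - 1) := by
        gcongr; exact hpow R' hR'
      rw [sub_eq_add_neg]
      refine ((isSignBounded_of_mem_cpSpace hN hβ.le hα.le hT).add
        (isSignBounded_of_mem_cpSpace hN hβ.le hα.le hM).neg (by positivity)
        (by positivity)).mono ?_
      have h3 := mul_le_mul_of_nonneg_right (add_le_add h2 h1) hα.le
      linarith
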